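/- For a topological space $X$ let $\mathrm{conv}(X)$ be the family of all $A\subseteq X$ that can be covered by the ranges of finitely many sequences convergent in $X$. For a countable ordinal $\alpha\ge 2$ let $\mathrm{conv}_\alpha=\mathrm{conv}(\omega^\alpha+1)$, where $\omega^\alpha+1=\{\xi:\xi\le\omega^\alpha\}$ carries the order topology (the same formula is used for $\alpha=0,1$). For a countable limit ordinal $\alpha$ let $$\mathrm{conv}_{<\alpha}=\{A\subseteq\omega^\alpha+1:\ \forall\beta<\alpha\ (A\cap\omega^\beta\in\mathrm{conv}_\beta)\},$$ where $A\cap\omega^\beta=\{\xi\in A:\xi<\omega^\beta\}$. An ideal on a set $X$ is a family of subsets of $X$ that is closed under subsets and finite unions, contains all finite sets, and does not contain $X$. Families of subsets of a countable set $X$ are viewed as subsets of the Cantor space $\{0,1\}^X$. For $n\geq 1$, a subset $S$ of a Polish space $Y$ is $\Sigma^0_n$-complete ($\Pi^0_n$-complete) if it is $\Sigma^0_n$ ($\Pi^0_n$) and every $\Sigma^0_n$ ($\Pi^0_n$) subset of every zero-dimensional Polish space $Z$ has the form $f^{-1}[S]$ for some continuous $f:Z\to Y$. For ideals $\mathcal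 I$ on $X$ and $\mathcal J$ on $Y$ write $\mathcal J\le_K\mathcal I$ if there is $f:X\to Y$ with $f^{-1}[A]\in\mathcal I$ for all $A\in\mathcal J$, and $\mathcal J<_K\mathcal I$ if $\mathcal J\le_K\mathcal I$ and $\mathcal I\not\le_K\mathcal J$. Then: 1. for every countable limit ordinal $\alpha$, $\mathrm{conv}_{<\alpha}$ is an ideal on $\omega^\alpha+1$ and is $\Pi^0_5$-complete; 2. for every countable ordinal $\alpha\ge2$, $\mathrm{conv}_\alpha$ is an ideal on $\omega^\alpha+1$ and is $\Sigma^0_4$-complete; 3. $\mathrm{conv}_\alpha<_K\mathrm{conv}_\beta$ for all countable ordinals $2\le\beta<\alpha$; 4. $\mathrm{conv}_{<\alpha}<_K\mathrm{conv}_{<\beta}$ for all countable limit ordinals $\beta<\alpha$; 5. $\mathrm{conv}_\alpha<_K\mathrm{conv}_{<\alpha}<_K\mathrm{conv}_\beta$ for every countable limit ordinal $\alpha$ and every $2\le\beta<\alpha$. -/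

import Mathlib

open Set Filter Topology
open scoped Ordinal

universe u v w

/-- `IsSigma0 n S`: the set `S` is `Σ⁰ₙ` (for finite `n ≥ 1`; there is no level `0`).
`Σ⁰₁` sets are the open sets, `Σ⁰ₙ₊₁` sets are the countable unions of `Π⁰ₙ` sets, and a set is
`Π⁰ₙ` when its complement is `Σ⁰ₙ`. -/
def IsSigma0 {X : Type u} [TopologicalSpace X] : ℕ → Set X → Prop
  | 0, _ => False
  | 1, S => IsOpen S
  | n + 2, S => ∃ P : ℕ → Set X, (∀ i, IsSigma0 (n + 1) (P i)ᶜ) ∧ S = ⋃ i, P i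

/-- `IsPi0 n S`: the set `S` is `Π⁰ₙ`. -/
def IsPi0 {X : Type u} [TopologicalSpace X] (n : ℕ) (S : Set X) : Prop :=
  IsSigma0 n Sᶜ

/-- A topological space is zero-dimensional if its clopen sets form a basis. -/
def IsZeroDimensional (X : Type u) [TopologicalSpace X] : Prop :=
  TopologicalSpace.IsTopologicalBasis {U : Set X | IsClopen U}

/-- `S ⊆ Y` is `Σ⁰ₙ`-complete: it is `Σ⁰ₙ`, and every `Σ⁰ₙ` subset of every zero-dimensional
Polish space (in the universe `v`) is the preimage of `S` under a continuous map. -/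
def IsSigma0Complete {Y : Type u} [TopologicalSpace Y] (n : ℕ) (S : Set Y) : Prop :=
  IsSigma0 n S ∧
    ∀ (X : Type v) [TopologicalSpace X] [PolishSpace X], IsZeroDimensional X →
      ∀ B : Set X, IsSigma0 n B → ∃ f : X → Y, Continuous f ∧ f ⁻¹' S = B

/-- `S ⊆ Y` is `Π⁰ₙ`-complete: it is `Π⁰ₙ`, and every `Π⁰ₙ` subset of every zero-dimensional
Polish space (in the universe `v`) is the preimage of `S` under a continuous map. -/
def IsPi0Complete {Y : Type u} [TopologicalSpace Y] (n : ℕ) (S : Set Y) : Prop :=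
  IsPi0 n S ∧
    ∀ (X : Type v) [TopologicalSpace X] [PolishSpace X], IsZeroDimensional X →
      ∀ B : Set X, IsPi0 n B → ∃ f : X → Y, Continuous f ∧ f ⁻¹' S = B

/-- An ideal on `X`: a proper family of subsets of `X`, closed under finite unions and under
subsets, that contains all finite sets. -/
structure IsIdealOn {X : Type u} (I : Set (Set X)) : Prop where
  empty_mem : ∅ ∈ I
  univ_notMem : univ ∉ I
  union_mem : ∀ A ∈ I, ∀ B ∈ I, A ∪ B ∈ I
  subset_mem : ∀ A B : Set X, A ⊆ B → B ∈ I → A ∈ I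
  finite_mem : ∀ A : Set X, A.Finite → A ∈ I

/-- `KatetovLE J I`: the ideal `J` on `Y` is below the ideal `I` on `X` in the Katětov order. -/
def KatetovLE {X : Type u} {Y : Type w} (J : Set (Set Y)) (I : Set (Set X)) : Prop :=
  ∃ f : X → Y, ∀ A ∈ J, f ⁻¹' A ∈ I

/-- `J` is strictly below `I` in the Katětov order. -/
def KatetovLT {X : Type u} {Y : Type w} (J : Set (Set Y)) (I : Set (Set X)) : Prop :=
  KatetovLE J I ∧ ¬ KatetovLE I J

/-- A family of subsets of `X`, viewed as a subset of the space `{0,1}^X` (with the product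
topology of the discrete two-point space) by identifying sets with characteristic functions. -/
def toCantor {X : Type u} (I : Set (Set X)) : Set (X → Bool) :=
  {χ | {x | χ x = true} ∈ I}

/-- The sets that can be covered by the ranges of finitely many convergent sequences in `X`. -/
def convIdeal (X : Type u) [TopologicalSpace X] : Set (Set X) :=
  {A | ∃ (k : ℕ) (d : Fin k → ℕ → X),
    (∀ i, ∃ p, Tendsto (d i) atTop (𝓝 p)) ∧ A ⊆ ⋃ i, range (d i)}

/-- The space `ω^α + 1 = {ξ : ξ ≤ ω^α}`. Its topology is the subspace topology from the order
topology of the ordinals, which is the order topology of `ω^α + 1`. -/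
abbrev OmegaPowSpace (α : Ordinal.{u}) : Type (u + 1) :=
  Iic (ω ^ α)

/-- The ideal `conv_α` on `ω^α + 1`. -/
def convOrd (α : Ordinal.{u}) : Set (Set (OmegaPowSpace α)) :=
  convIdeal (OmegaPowSpace α)

/-- The ideal `conv_{<α}` on `ω^α + 1`: all `A` with `A ∩ ω^β ∈ conv_β` for every `β < α`, where
`A ∩ ω^β = {ξ ∈ A : ξ < ω^β}` is regarded as a subset of `ω^β + 1`. -/
def convBelow (α : Ordinal.{u}) : Set (Set (OmegaPowSpace α)) :=
  {A | ∀ β < α,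
    {ξ : OmegaPowSpace β | (ξ : Ordinal) ∈ ((↑) '' A : Set Ordinal) ∩ Iio (ω ^ β)} ∈ convOrd β}

/-!
In a countable compact Hausdorff space a set lies in the ideal `conv` if and only if it has only
finitely many accumulation points. That a given point is not an accumulation point of a set is a
`Σ⁰₂` condition on the set, so membership in `conv` is a `Σ⁰₄` condition, and a
countable intersection of such conditions is `Π⁰₅`.

For the lower bounds, consider the isolated points `ω * n + m + 1` of `ω ^ 2` as an array with rows
indexed by `n`. A subset of the array lies in `conv` if and only if all but finitely many of its
rows are finite. Splitting Borel sets of low rank into countable disjoint unions turns membership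
in an arbitrary `Σ⁰₄` set of a zero-dimensional space into exactly this condition on an array of
clopen sets. For `conv_{<α}` one places a copy of the array in each of countably many disjoint
blocks cofinal in `ω ^ α`, and each copy simulates one factor of an intersection of `Σ⁰₄` sets.

For the Katětov order, suppose that preimages under `f : X → Y` of `conv` sets are `conv` sets.
Then a value `y` is a cluster value of `f` at only finitely many `x`, and for `γ ≥ 2` a point of
Cantor–Bendixson rank at least `γ` has a cluster value of rank at least `γ`. Hence `X` has only
finitely many points of rank at least `γ` if `Y` has. This fails for `X = ω ^ α + 1`,
`Y = ω ^ β + 1`, `γ = β` with `α > β`, since `ω ^ ξ + 1` has exactly one point of rank at least `ξ`.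
-/

section ConvIdeal

variable {X : Type u} {Y : Type w} [TopologicalSpace X] [TopologicalSpace Y]

theorem convIdeal_mono {A B : Set X} (h : A ⊆ B) (hB : B ∈ convIdeal X) : A ∈ convIdeal X :=
  let ⟨k, d, hd, hBd⟩ := hB
  ⟨k, d, hd, h.trans hBd⟩

theorem empty_mem_convIdeal : (∅ : Set X) ∈ convIdeal X :=
  ⟨0, Fin.elim0, fun i => i.elim0, empty_subset _⟩

theorem range_mem_convIdeal {d : ℕ → X} {p : X} (hd : Tendsto d atTop (𝓝 p)) :
    range d ∈ convIdeal X :=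
  ⟨1, fun _ => d, fun _ => ⟨p, hd⟩, subset_iUnion (fun _ : Fin 1 => range d) 0⟩

theorem union_mem_convIdeal {A B : Set X} (hA : A ∈ convIdeal X) (hB : B ∈ convIdeal X) :
    A ∪ B ∈ convIdeal X := by
  obtain ⟨k, d, hd, hA⟩ := hA
  obtain ⟨l, e, he, hB⟩ := hB
  refine ⟨k + l, Fin.append d e, fun i => ?_, union_subset (hA.trans ?_) (hB.trans ?_)⟩
  · exact Fin.addCases (by simpa using hd) (by simpa using he) i
  · exact iUnion_subset fun i => subset_iUnion_of_subset (Fin.castAdd l i) (by simp)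
  · exact iUnion_subset fun i => subset_iUnion_of_subset (Fin.natAdd k i) (by simp)

theorem biUnion_mem_convIdeal {ι : Type*} {s : Set ι} (hs : s.Finite) {A : ι → Set X}
    (hA : ∀ i ∈ s, A i ∈ convIdeal X) : ⋃ i ∈ s, A i ∈ convIdeal X := by
  induction s, hs using Set.Finite.induction_on with
  | empty => simpa using empty_mem_convIdeal
  | insert _ _ ih =>
    rw [biUnion_insert]
    exact union_mem_convIdeal (hA _ (mem_insert _ _)) (ih fun i hi => hA i (mem_insert_of_mem _ hi))

theorem mem_convIdeal_of_finite {A : Set X} (hA : A.Finite) : A ∈ convIdeal X := by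
  rw [← biUnion_of_singleton A]
  refine biUnion_mem_convIdeal hA fun x _ => ?_
  simpa using range_mem_convIdeal (d := fun _ => x) tendsto_const_nhds

theorem cofinite_inf_principal_range_le_nhds {d : ℕ → X} {p : X} (hd : Tendsto d atTop (𝓝 p)) :
    cofinite ⊓ 𝓟 (range d) ≤ 𝓝 p := by
  intro V hV
  have hfin : (d ⁻¹' V)ᶜ.Finite := by
    rw [← Nat.cofinite_eq_atTop] at hd
    exact hd hV
  refine mem_inf_principal.2 ((hfin.image d).subset ?_)
  intro x hx
  obtain ⟨⟨n, rfl⟩, hn⟩ : x ∈ range d ∧ x ∉ V := by simpa using hx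
  exact mem_image_of_mem d hn

theorem mem_convIdeal_of_cofinite_inf_principal_le_nhds {A : Set X} (hA : A.Countable) {p : X}
    (h : cofinite ⊓ 𝓟 A ≤ 𝓝 p) : A ∈ convIdeal X := by
  rcases A.finite_or_infinite with hfin | hinf
  · exact mem_convIdeal_of_finite hfin
  have : Countable A := hA
  have : Infinite A := hinf.to_subtype
  obtain ⟨e⟩ := nonempty_equiv_of_countable (α := ℕ) (β := A)
  have he : Tendsto (fun n => (e n : X)) atTop (cofinite ⊓ 𝓟 A) := by
    rw [← Nat.cofinite_eq_atTop]
    exact tendsto_inf.2 ⟨(Subtype.val_injective.comp e.injective).tendsto_cofinite,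
      tendsto_principal.2 (.of_forall fun n => (e n).2)⟩
  refine convIdeal_mono (fun x hx => ?_) (range_mem_convIdeal (he.mono_right h))
  exact ⟨e.symm ⟨x, hx⟩, by simp⟩

theorem image_mem_convIdeal {f : X → Y} (hf : Continuous f) {A : Set X} (hA : A ∈ convIdeal X) :
    f '' A ∈ convIdeal Y := by
  obtain ⟨k, d, hd, hA⟩ := hA
  refine ⟨k, fun i => f ∘ d i, fun i => ?_, ?_⟩
  · obtain ⟨p, hp⟩ := hd i
    exact ⟨f p, (hf.tendsto p).comp hp⟩
  · simpa only [image_iUnion, range_comp] using image_mono hA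

theorem preimage_mem_convIdeal {f : X → Y} (hf : IsClosedEmbedding f) {A : Set Y}
    (hA : A ∈ convIdeal Y) : f ⁻¹' A ∈ convIdeal X := by
  obtain ⟨k, d, hd, hA⟩ := hA
  have hmono : f ⁻¹' A ⊆ ⋃ i ∈ (univ : Set (Fin k)), f ⁻¹' range (d i) := by
    simpa using preimage_mono hA
  refine convIdeal_mono hmono (biUnion_mem_convIdeal finite_univ fun i _ => ?_)
  obtain ⟨p, hp⟩ := hd i
  by_cases hpf : p ∈ range f
  · obtain ⟨q, rfl⟩ := hpf
    refine mem_convIdeal_of_cofinite_inf_principal_le_nhds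
      ((countable_range _).preimage hf.injective) (p := q) ?_
    rw [hf.nhds_eq_comap, ← map_le_iff_le_comap]
    refine le_trans (le_inf ?_ ?_) (cofinite_inf_principal_range_le_nhds hp)
    · exact (map_mono inf_le_left).trans hf.injective.tendsto_cofinite
    · exact (map_mono inf_le_right).trans (by simp [map_principal])
  · have hfin : (range (d i) ∩ range f).Finite := by
      have hcompl := cofinite_inf_principal_range_le_nhds hp
        (hf.isClosed_range.isOpen_compl.mem_nhds hpf)
      refine Finite.subset (mem_inf_principal.1 hcompl) ?_
      rintro y ⟨hyd, hyf⟩ hy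
      exact hy hyd hyf
    rw [← preimage_inter_range]
    exact mem_convIdeal_of_finite (hfin.preimage hf.injective.injOn)

theorem image_mem_convIdeal_iff {f : X → Y} (hf : IsClosedEmbedding f) {A : Set X} :
    f '' A ∈ convIdeal Y ↔ A ∈ convIdeal X := by
  refine ⟨fun h => ?_, image_mem_convIdeal hf.continuous⟩
  simpa [preimage_image_eq _ hf.injective] using preimage_mem_convIdeal hf h

theorem accPt_principal_iff_clusterPt_cofinite [T1Space X] {A : Set X} {x : X} :
    AccPt x (𝓟 A) ↔ ClusterPt x (cofinite ⊓ 𝓟 A) := by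
  rw [accPt_iff_clusterPt]
  refine ⟨fun h => NeBot.mono h ?_, fun h => h.mono ?_⟩
  · have hcof : 𝓝 x ⊓ (𝓟 {x}ᶜ ⊓ 𝓟 A) ≤ cofinite :=
      (inf_le_inf_left _ inf_le_left).trans (nhdsNE_le_cofinite x)
    exact le_inf inf_le_left (le_inf hcof (inf_le_right.trans inf_le_right))
  · exact inf_le_inf_right _ (le_principal_iff.2 (finite_singleton x).compl_mem_cofinite)

theorem finite_of_derivedSet_eq_empty [CompactSpace X] {A : Set X} (hA : derivedSet A = ∅) :
    A.Finite := by
  by_contra hinf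
  obtain ⟨x, hx⟩ := Set.Infinite.exists_accPt_principal hinf
  exact hA.subset hx

theorem mem_convIdeal_of_derivedSet_subset_singleton [T1Space X] [CompactSpace X] {A : Set X}
    (hA : A.Countable) {p : X} (hp : derivedSet A ⊆ {p}) : A ∈ convIdeal X :=
  mem_convIdeal_of_cofinite_inf_principal_le_nhds hA <| le_nhds_of_unique_clusterPt fun _ hx =>
    hp (accPt_principal_iff_clusterPt_cofinite.2 hx)

theorem derivedSet_range_subset_singleton [T2Space X] {d : ℕ → X} {p : X}
    (hd : Tendsto d atTop (𝓝 p)) : derivedSet (range d) ⊆ {p} := fun _ hx =>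
  eq_of_nhds_neBot <| (accPt_principal_iff_clusterPt_cofinite.1 hx).mono
    (cofinite_inf_principal_range_le_nhds hd)

theorem finite_derivedSet_of_mem_convIdeal [T2Space X] {A : Set X} (hA : A ∈ convIdeal X) :
    (derivedSet A).Finite := by
  obtain ⟨k, d, hd, hA⟩ := hA
  choose p hp using hd
  refine (finite_range p).subset fun x hx => ?_
  by_contra hxp
  have hnot : ∀ᶠ y in 𝓝[≠] x, ∀ i, y ∉ range (d i) := eventually_all.2 fun i => by
    by_contra hfreq
    exact hxp ⟨i, (derivedSet_range_subset_singleton (hp i)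
      (accPt_iff_frequently_nhdsNE.2 hfreq)).symm⟩
  refine accPt_iff_frequently_nhdsNE.1 hx (hnot.mono fun y hy hyA => ?_)
  obtain ⟨i, hi⟩ := mem_iUnion.1 (hA hyA)
  exact hy i hi

theorem mem_convIdeal_iff_finite_derivedSet [T2Space X] [CompactSpace X] {A : Set X}
    (hA : A.Countable) : A ∈ convIdeal X ↔ (derivedSet A).Finite := by
  refine ⟨finite_derivedSet_of_mem_convIdeal, fun hfin => ?_⟩
  obtain ⟨U, hU, hdisj⟩ := hfin.t2_separation
  have hmeet {B : Set X} {x : X} (hx : x ∈ derivedSet B) : (U x ∩ B).Nonempty :=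
    (accPt_iff_nhds.1 hx (U x) ((hU x).2.mem_nhds (hU x).1)).imp fun _ hy => hy.1
  have hfar : (A \ ⋃ p ∈ derivedSet A, U p).Finite := by
    refine finite_of_derivedSet_eq_empty (eq_empty_of_forall_notMem fun x hx => ?_)
    obtain ⟨y, hyU, hy⟩ := hmeet hx
    exact hy.2 (mem_biUnion (derivedSet_mono _ _ sdiff_subset hx) hyU)
  have hnear : ∀ p ∈ derivedSet A, A ∩ U p ∈ convIdeal X := fun p hp => by
    refine mem_convIdeal_of_derivedSet_subset_singleton (hA.mono inter_subset_left) (p := p) ?_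
    intro q hq
    by_contra hqp
    obtain ⟨y, hyU, hy⟩ := hmeet hq
    exact disjoint_left.1 (hdisj (derivedSet_mono _ _ inter_subset_left hq) hp hqp) hyU hy.2
  refine convIdeal_mono ?_
    (union_mem_convIdeal (mem_convIdeal_of_finite hfar) (biUnion_mem_convIdeal hfin hnear))
  rw [← inter_iUnion₂, sdiff_union_inter]

end ConvIdeal

section OmegaPowSpace

variable {α β : Ordinal.{u}}

theorem KatetovLE.trans {X : Type u} {Y : Type v} {Z : Type w} {I : Set (Set X)} {J : Set (Set Y)}
    {K : Set (Set Z)} (hKJ : KatetovLE K J) (hJI : KatetovLE J I) : KatetovLE K I :=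
  let ⟨g, hg⟩ := hKJ
  let ⟨f, hf⟩ := hJI
  ⟨g ∘ f, fun A hA => hf _ (hg A hA)⟩

theorem isIdealOn_convIdeal {X : Type u} [TopologicalSpace X] (hX : univ ∉ convIdeal X) :
    IsIdealOn (convIdeal X) where
  empty_mem := empty_mem_convIdeal
  univ_notMem := hX
  union_mem _ hA _ hB := union_mem_convIdeal hA hB
  subset_mem _ _ := convIdeal_mono
  finite_mem _ := mem_convIdeal_of_finite

/-- The inclusion of `ω^β + 1` into `ω^α + 1` as an initial segment. -/
def OmegaPowSpace.inclusion (h : β ≤ α) : OmegaPowSpace β → OmegaPowSpace α :=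
  Set.inclusion (Iic_subset_Iic.2 (Ordinal.opow_le_opow_right Ordinal.omega0_pos h))

theorem OmegaPowSpace.isClosedEmbedding_inclusion (h : β ≤ α) :
    IsClosedEmbedding (OmegaPowSpace.inclusion h) :=
  IsClosedEmbedding.inclusion (Iic_subset_Iic.2 (Ordinal.opow_le_opow_right Ordinal.omega0_pos h))
    (isClosed_Iic.preimage continuous_subtype_val)

theorem mem_convBelow_iff {A : Set (OmegaPowSpace α)} :
    A ∈ convBelow α ↔ ∀ β < α, A ∩ {ξ | (ξ : Ordinal) < ω ^ β} ∈ convOrd α := by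
  refine forall₂_congr fun β hβ => ?_
  rw [convOrd, convOrd,
    ← image_mem_convIdeal_iff (OmegaPowSpace.isClosedEmbedding_inclusion hβ.le)]
  congr! 1
  ext ξ
  constructor
  · rintro ⟨ζ, ⟨⟨ξ, hξ, hζ⟩, hlt⟩, rfl⟩
    obtain rfl : ξ = OmegaPowSpace.inclusion hβ.le ζ := Subtype.ext hζ
    exact ⟨hξ, hlt⟩
  · rintro ⟨hξ, hlt⟩
    exact ⟨⟨ξ, mem_Iic.2 (le_of_lt hlt)⟩, ⟨mem_image_of_mem _ hξ, hlt⟩, rfl⟩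

theorem convBelow_mono {A B : Set (OmegaPowSpace α)} (h : A ⊆ B) (hB : B ∈ convBelow α) :
    A ∈ convBelow α :=
  mem_convBelow_iff.2 fun β hβ =>
    convIdeal_mono (inter_subset_inter_left _ h) (mem_convBelow_iff.1 hB β hβ)

theorem convOrd_subset_convBelow : convOrd α ⊆ convBelow α := fun _ hA =>
  mem_convBelow_iff.2 fun _ _ => convIdeal_mono inter_subset_left hA

theorem isIdealOn_convBelow_of_univ_notMem (hα : univ ∉ convBelow α) :
    IsIdealOn (convBelow α) where
  empty_mem := convOrd_subset_convBelow empty_mem_convIdeal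
  univ_notMem := hα
  union_mem A hA B hB := mem_convBelow_iff.2 fun β hβ => by
    rw [union_inter_distrib_right]
    exact union_mem_convIdeal (mem_convBelow_iff.1 hA β hβ) (mem_convBelow_iff.1 hB β hβ)
  subset_mem _ _ := convBelow_mono
  finite_mem _ hA := convOrd_subset_convBelow (mem_convIdeal_of_finite hA)

theorem iUnion_mem_convBelow {A : ℕ → Set (OmegaPowSpace α)} (hA : ∀ k, A k ∈ convOrd α)
    (hlt : ∀ β < α, ∀ᶠ k in atTop, ∀ ξ ∈ A k, ω ^ β ≤ (ξ : Ordinal)) :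
    ⋃ k, A k ∈ convBelow α := by
  refine mem_convBelow_iff.2 fun β hβ => ?_
  obtain ⟨N, hN⟩ := eventually_atTop.1 (hlt β hβ)
  refine convIdeal_mono ?_ (biUnion_mem_convIdeal (finite_lt_nat N) fun k _ => hA k)
  rintro ξ ⟨hξ, hξβ⟩
  obtain ⟨k, hk⟩ := mem_iUnion.1 hξ
  refine mem_biUnion (show k < N from ?_) hk
  by_contra hkN
  exact (hN k (not_lt.1 hkN) ξ hk).not_gt hξβ

theorem katetovLE_convOrd (h : β ≤ α) : KatetovLE (convOrd α) (convOrd β) :=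
  ⟨OmegaPowSpace.inclusion h, fun _ hA =>
    preimage_mem_convIdeal (OmegaPowSpace.isClosedEmbedding_inclusion h) hA⟩

theorem katetovLE_convOrd_convBelow : KatetovLE (convOrd α) (convBelow α) :=
  ⟨id, fun _ hA => convOrd_subset_convBelow hA⟩

theorem katetovLE_convBelow_convOrd (h : β < α) : KatetovLE (convBelow α) (convOrd β) := by
  have hincl := OmegaPowSpace.isClosedEmbedding_inclusion h.le
  refine ⟨OmegaPowSpace.inclusion h.le, fun A hA => ?_⟩
  refine convIdeal_mono (fun ξ hξ => ?_) (union_mem_convIdeal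
    (preimage_mem_convIdeal hincl (mem_convBelow_iff.1 hA β h))
    (mem_convIdeal_of_finite (finite_singleton ⟨ω ^ β, self_mem_Iic⟩)))
  rcases (show (ξ : Ordinal) ≤ ω ^ β from ξ.2).lt_or_eq with hlt | heq
  · exact Or.inl ⟨hξ, hlt⟩
  · exact Or.inr (Subtype.ext heq)

theorem katetovLE_convBelow (h : β < α) : KatetovLE (convBelow α) (convBelow β) :=
  (katetovLE_convBelow_convOrd h).trans katetovLE_convOrd_convBelow

end OmegaPowSpace

section BorelHierarchy

variable {X : Type u} {Y : Type v} [TopologicalSpace X] [TopologicalSpace Y] {n : ℕ}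

theorem isSigma0_one {S : Set X} : IsSigma0 1 S ↔ IsOpen S := by rw [IsSigma0]

theorem isSigma0_add_two {S : Set X} :
    IsSigma0 (n + 2) S ↔ ∃ P : ℕ → Set X, (∀ i, IsPi0 (n + 1) (P i)) ∧ S = ⋃ i, P i := by
  rw [IsSigma0]
  rfl

theorem isPi0_one {S : Set X} : IsPi0 1 S ↔ IsClosed S := by
  rw [IsPi0, isSigma0_one, isOpen_compl_iff]

theorem IsSigma0.isPi0_compl {S : Set X} (hS : IsSigma0 n S) : IsPi0 n Sᶜ := by
  rwa [IsPi0, compl_compl]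

theorem IsPi0.isSigma0_succ {S : Set X} (hS : IsPi0 (n + 1) S) : IsSigma0 (n + 2) S :=
  isSigma0_add_two.2 ⟨fun _ => S, fun _ => hS, (iUnion_const S).symm⟩

theorem IsSigma0.isPi0_succ {S : Set X} (hS : IsSigma0 (n + 1) S) : IsPi0 (n + 2) S :=
  hS.isPi0_compl.isSigma0_succ

theorem isSigma0_empty_and_univ :
    IsSigma0 (n + 1) (∅ : Set X) ∧ IsSigma0 (n + 1) (univ : Set X) := by
  induction n with
  | zero => exact ⟨isSigma0_one.2 isOpen_empty, isSigma0_one.2 isOpen_univ⟩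
  | succ n ih =>
    exact ⟨IsPi0.isSigma0_succ (by rw [IsPi0, compl_empty]; exact ih.2),
      IsPi0.isSigma0_succ (by rw [IsPi0, compl_univ]; exact ih.1)⟩

theorem IsSigma0.iUnion {ι : Type*} [Countable ι] {S : ι → Set X}
    (hS : ∀ i, IsSigma0 (n + 1) (S i)) : IsSigma0 (n + 1) (⋃ i, S i) := by
  cases n with
  | zero => exact isSigma0_one.2 (isOpen_iUnion fun i => isSigma0_one.1 (hS i))
  | succ n =>
    rcases isEmpty_or_nonempty ι with hι | hι
    · simpa using isSigma0_empty_and_univ.1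
    choose P hP hSP using fun i => isSigma0_add_two.1 (hS i)
    obtain ⟨e, he⟩ := exists_surjective_nat (ι × ℕ)
    refine isSigma0_add_two.2 ⟨fun k => P (e k).1 (e k).2, fun k => hP _ _, ?_⟩
    rw [he.iUnion_comp fun q => P q.1 q.2, iUnion_prod', iUnion_congr hSP]

theorem IsPi0.iInter {ι : Type*} [Countable ι] {S : ι → Set X}
    (hS : ∀ i, IsPi0 (n + 1) (S i)) : IsPi0 (n + 1) (⋂ i, S i) := by
  rw [IsPi0, compl_iInter]
  exact .iUnion hS

theorem IsPi0.inter {S T : Set X} (hS : IsPi0 (n + 1) S) (hT : IsPi0 (n + 1) T) :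
    IsPi0 (n + 1) (S ∩ T) := by
  rw [inter_eq_iInter]
  exact .iInter (Bool.forall_bool.2 ⟨hT, hS⟩)

theorem IsSigma0.preimage {f : X → Y} (hf : Continuous f) {S : Set Y}
    (hS : IsSigma0 (n + 1) S) : IsSigma0 (n + 1) (f ⁻¹' S) := by
  induction n generalizing S with
  | zero => exact isSigma0_one.2 ((isSigma0_one.1 hS).preimage hf)
  | succ n ih =>
    obtain ⟨P, hP, rfl⟩ := isSigma0_add_two.1 hS
    exact isSigma0_add_two.2 ⟨fun i => f ⁻¹' P i, fun i => ih (hP i), preimage_iUnion⟩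

end BorelHierarchy

section UpperBounds

variable {X : Type u} [TopologicalSpace X]

theorem isSigma0_two_setOf_notMem_derivedSet [FirstCountableTopology X] (x : X) :
    IsSigma0 2 {χ : X → Bool | x ∉ derivedSet {z | χ z = true}} := by
  obtain ⟨V, hV⟩ := (𝓝[≠] x).exists_antitone_basis
  have hset : {χ : X → Bool | x ∉ derivedSet {z | χ z = true}} =
      ⋃ i, ⋂ z ∈ V i, {χ | χ z = true}ᶜ := by
    ext χ
    simp [accPt_iff_frequently_nhdsNE, hV.eventually_iff]
  rw [hset]
  refine IsSigma0.iUnion fun i => IsPi0.isSigma0_succ (isPi0_one.2 ?_)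
  exact isClosed_biInter fun z _ => isClosed_compl_iff.2 <|
    (isOpen_discrete {true}).preimage (continuous_apply (A := fun _ => Bool) z)

theorem isSigma0_four_setOf_finite_derivedSet [Countable X] [FirstCountableTopology X] :
    IsSigma0 4 {χ : X → Bool | (derivedSet {z | χ z = true}).Finite} := by
  have hset : {χ : X → Bool | (derivedSet {z | χ z = true}).Finite} =
      ⋃ F : Finset X, ⋂ x : {x // x ∉ F}, {χ | x.1 ∉ derivedSet {z | χ z = true}} := by
    ext χ
    simp only [mem_iUnion, mem_iInter, mem_ofPred_eq, Subtype.forall]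
    refine ⟨fun hfin => ⟨hfin.toFinset, by simp⟩, fun ⟨F, hF⟩ => ?_⟩
    exact F.finite_toSet.subset fun x hx => by_contra fun hxF => hF x hxF hx
  rw [hset]
  exact IsSigma0.iUnion fun F => IsPi0.isSigma0_succ <| IsPi0.iInter fun x =>
    (isSigma0_two_setOf_notMem_derivedSet x.1).isPi0_succ

theorem isSigma0_toCantor_convIdeal [Countable X] [T2Space X] [CompactSpace X]
    [FirstCountableTopology X] : IsSigma0 4 (toCantor (convIdeal X)) := by
  have hset : toCantor (convIdeal X) = {χ : X → Bool | (derivedSet {z | χ z = true}).Finite} :=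
    ext fun χ => mem_convIdeal_iff_finite_derivedSet (to_countable _)
  rw [hset]
  exact isSigma0_four_setOf_finite_derivedSet

variable {α : Ordinal.{u}}

theorem countable_Iio_of_card_le_aleph0 (hα : α.card ≤ Cardinal.aleph0) : Countable (Iio α) := by
  rw [← Cardinal.mk_le_aleph0_iff, Cardinal.mk_Iio_ordinal]
  simpa using Cardinal.lift_le.{u + 1}.2 hα

theorem countable_omegaPowSpace (hα : α.card ≤ Cardinal.aleph0) :
    Countable (OmegaPowSpace α) := by
  have hcard : (ω ^ α).card ≤ Cardinal.aleph0 :=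
    (Ordinal.card_opow_le _ _).trans (by simp [hα])
  have := countable_Iio_of_card_le_aleph0 hcard
  rw [OmegaPowSpace, ← Iio_insert]
  exact (to_countable (Iio (ω ^ α))).insert _

theorem compactSpace_omegaPowSpace (α : Ordinal.{u}) : CompactSpace (OmegaPowSpace α) := by
  rw [← isCompact_iff_compactSpace, ← Icc_bot]
  exact isCompact_Icc

theorem firstCountableTopology_of_orderTopology (X : Type*) [Preorder X] [Countable X]
    [TopologicalSpace X] [OrderTopology X] : FirstCountableTopology X := by
  refine ⟨fun x => ?_⟩
  rw [nhds_eq_order]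
  infer_instance

theorem isSigma0_toCantor_convOrd (hα : α.card ≤ Cardinal.aleph0) :
    IsSigma0 4 (toCantor (convOrd α)) :=
  have := compactSpace_omegaPowSpace α
  have := countable_omegaPowSpace hα
  have := firstCountableTopology_of_orderTopology (OmegaPowSpace α)
  isSigma0_toCantor_convIdeal

theorem isPi0_toCantor_convBelow (hα : α.card ≤ Cardinal.aleph0) :
    IsPi0 5 (toCantor (convBelow α)) := by
  have := countable_Iio_of_card_le_aleph0 hα
  let restrict (β : Ordinal.{u}) (χ : OmegaPowSpace α → Bool) (ξ : OmegaPowSpace α) : Bool :=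
    χ ξ && decide ((ξ : Ordinal) < ω ^ β)
  have hcont (β : Ordinal.{u}) : Continuous (restrict β) := continuous_pi fun ξ =>
    continuous_of_discreteTopology (f := (· && decide ((ξ : Ordinal) < ω ^ β))) |>.comp
      (continuous_apply ξ)
  have hset : toCantor (convBelow α) =
      ⋂ β : Iio α, restrict β ⁻¹' toCantor (convOrd α) := by
    ext χ
    simp [toCantor, mem_convBelow_iff, restrict, ofPred_and]
  rw [hset]
  exact IsPi0.iInter fun β =>
    ((isSigma0_toCantor_convOrd hα).preimage (hcont β)).isPi0_succ

end UpperBounds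

section DisjointUnions

variable {X : Type u} {Γ : Set (Set X)} {S T : Set X}

/-- `S` is the union of a pairwise disjoint sequence of members of `Γ`. Since a point of `S` then
lies in exactly one of these members, membership in `S` can be turned into a count. -/
def IsCountableDisjointUnion (Γ : Set (Set X)) (S : Set X) : Prop :=
  ∃ D : ℕ → Set X, (∀ c, D c ∈ Γ) ∧ Pairwise (Function.onFun Disjoint D) ∧ ⋃ c, D c = S

namespace IsCountableDisjointUnion

theorem mono {Γ' : Set (Set X)} (h : Γ ⊆ Γ') (hS : IsCountableDisjointUnion Γ S) :
    IsCountableDisjointUnion Γ' S :=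
  let ⟨D, hD, hdisj, hDS⟩ := hS
  ⟨D, fun c => h (hD c), hdisj, hDS⟩

theorem of_countable (h0 : ∅ ∈ Γ) {ι : Type*} [Countable ι] {D : ι → Set X} (hD : ∀ i, D i ∈ Γ)
    (hdisj : Pairwise (Function.onFun Disjoint D)) : IsCountableDisjointUnion Γ (⋃ i, D i) :=
  have := Encodable.ofCountable ι
  ⟨fun c => ⋃ i ∈ Encodable.decode₂ ι c, D i,
    fun _ => Encodable.iUnion_decode₂_cases (C := (· ∈ Γ)) h0 hD,
    Encodable.iUnion_decode₂_disjoint_on hdisj, Encodable.iUnion_decode₂ D⟩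

theorem of_mem (h0 : ∅ ∈ Γ) (hS : S ∈ Γ) : IsCountableDisjointUnion Γ S := by
  rw [← iUnion_const (ι := Unit) S]
  exact of_countable h0 (fun _ => hS) fun i j hij => (hij (Subsingleton.elim i j)).elim

theorem iUnion (h0 : ∅ ∈ Γ) {S : ℕ → Set X} (hS : ∀ k, IsCountableDisjointUnion Γ (S k))
    (hdisj : Pairwise (Function.onFun Disjoint S)) : IsCountableDisjointUnion Γ (⋃ k, S k) := by
  choose D hD hDdisj hDS using hS
  rw [← iUnion_congr hDS, ← iUnion_prod' fun q : ℕ × ℕ => D q.1 q.2]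
  refine of_countable h0 (fun q => hD q.1 q.2) ?_
  rintro ⟨k, c⟩ ⟨k', c'⟩ hne
  rcases eq_or_ne k k' with rfl | hk
  · exact hDdisj k fun hc => hne (Prod.ext rfl hc)
  · exact (hdisj hk).mono ((subset_iUnion (D k) c).trans_eq (hDS k))
      ((subset_iUnion (D k') c').trans_eq (hDS k'))

theorem inter (h0 : ∅ ∈ Γ) (hΓ : FiniteInter Γ) (hS : IsCountableDisjointUnion Γ S)
    (hT : IsCountableDisjointUnion Γ T) : IsCountableDisjointUnion Γ (S ∩ T) := by
  obtain ⟨D, hD, hDdisj, rfl⟩ := hS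
  obtain ⟨E, hE, hEdisj, rfl⟩ := hT
  rw [iUnion_inter_iUnion, ← iUnion_prod' fun q : ℕ × ℕ => D q.1 ∩ E q.2]
  refine of_countable h0 (fun q => hΓ.inter_mem (hD q.1) (hE q.2)) ?_
  rintro ⟨c, e⟩ ⟨c', e'⟩ hne
  rcases eq_or_ne c c' with rfl | hc
  · exact (hEdisj fun he => hne (Prod.ext rfl he)).mono inter_subset_right inter_subset_right
  · exact (hDdisj hc).mono inter_subset_left inter_subset_left

theorem biInter_lt (h0 : ∅ ∈ Γ) (hΓ : FiniteInter Γ) {S : ℕ → Set X}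
    (hS : ∀ i, IsCountableDisjointUnion Γ (S i)) (m : ℕ) :
    IsCountableDisjointUnion Γ (⋂ i < m, S i) := by
  induction m with
  | zero => simpa using of_mem h0 hΓ.univ_mem
  | succ m ih => simpa only [biInter_lt_succ] using ih.inter h0 hΓ (hS m)

theorem iUnion_of_compl (h0 : ∅ ∈ Γ) (hΓ : FiniteInter Γ) {P : ℕ → Set X} (hP : ∀ k, P k ∈ Γ)
    (hPc : ∀ k, IsCountableDisjointUnion Γ (P k)ᶜ) : IsCountableDisjointUnion Γ (⋃ k, P k) := by
  rw [← iUnion_disjointed]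
  refine iUnion h0 (fun k => ?_) (disjoint_disjointed P)
  exact disjointedRec (fun _ i ht => ht.inter h0 hΓ (hPc i)) (of_mem h0 (hP k))

/-- With `D m` partitioning `⋂ i < m, (P i)ᶜ`, a point lies in one member of `D m` for each `m` up
to the first `P i` that contains it, and in one for every `m` if there is none. -/
theorem exists_mem_iUnion_iff_finite (h0 : ∅ ∈ Γ) (hΓ : FiniteInter Γ) {P : ℕ → Set X}
    (hP : ∀ i, IsCountableDisjointUnion Γ (P i)ᶜ) :
    ∃ E : ℕ → Set X, (∀ j, E j ∈ Γ) ∧ ∀ x, x ∈ ⋃ i, P i ↔ {j | x ∈ E j}.Finite := by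
  choose D hD hdisj hDP using biInter_lt h0 hΓ hP
  refine ⟨fun j => D j.unpair.1 j.unpair.2, fun j => hD _ _, fun x => ?_⟩
  have hinj : InjOn (fun j : ℕ => j.unpair.1) {j | x ∈ D j.unpair.1 j.unpair.2} := by
    intro j hj j' hj' hjj'
    replace hjj' : j.unpair.1 = j'.unpair.1 := hjj'
    have hj' : x ∈ D j.unpair.1 j'.unpair.2 := by rw [hjj']; exact hj'
    have hsnd : j.unpair.2 = j'.unpair.2 :=
      (hdisj _).eq (not_disjoint_iff.2 ⟨x, hj, hj'⟩)
    exact Nat.pairEquiv.symm.injective (Prod.ext hjj' hsnd)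
  have himage : (fun j : ℕ => j.unpair.1) '' {j | x ∈ D j.unpair.1 j.unpair.2} =
      {m | ∀ i < m, x ∉ P i} := by
    ext m
    have hmem : (∃ c, x ∈ D m c) ↔ ∀ i < m, x ∉ P i := by
      rw [← mem_iUnion, hDP]
      simp
    rw [mem_ofPred_eq, ← hmem]
    exact ⟨fun ⟨j, hj, hjm⟩ => ⟨j.unpair.2, hjm ▸ hj⟩,
      fun ⟨c, hc⟩ => ⟨Nat.pair m c, by simpa using hc, by simp⟩⟩
  rw [← finite_image_iff hinj, himage, mem_iUnion]
  constructor
  · rintro ⟨i, hi⟩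
    exact (finite_le_nat i).subset fun m hm => not_lt.1 fun him => hm i him hi
  · contrapose!
    intro hx
    simpa [hx] using infinite_univ

end IsCountableDisjointUnion

end DisjointUnions

section Reductions

variable {X : Type u} [TopologicalSpace X] {n : ℕ}

theorem finiteInter_isClopen : FiniteInter {C : Set X | IsClopen C} :=
  ⟨isClopen_univ, fun _ hC _ hD => hC.inter hD⟩

theorem empty_mem_setOf_isPi0 : (∅ : Set X) ∈ {S | IsPi0 (n + 1) S} := by
  simpa [IsPi0] using isSigma0_empty_and_univ.2

theorem finiteInter_isPi0 : FiniteInter {S : Set X | IsPi0 (n + 1) S} :=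
  ⟨by simpa [IsPi0] using isSigma0_empty_and_univ.1, fun _ hS _ hT => hS.inter hT⟩

variable [SecondCountableTopology X]

theorem IsZeroDimensional.exists_clopen_iUnion (hX : IsZeroDimensional X) {U : Set X}
    (hU : IsOpen U) : ∃ C : ℕ → Set X, (∀ n, IsClopen (C n)) ∧ U = ⋃ n, C n := by
  obtain ⟨ι, C, rfl, hC⟩ := hX.open_eq_iUnion hU
  obtain ⟨T, hT, hTC⟩ := TopologicalSpace.isOpen_iUnion_countable C fun i => (hC i).isOpen
  have := hT.toEncodable
  refine ⟨fun n => ⋃ i ∈ Encodable.decode₂ T n, C i, fun _ => ?_, ?_⟩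
  · exact Encodable.iUnion_decode₂_cases (C := IsClopen) isClopen_empty fun i : T => hC i
  · rw [Encodable.iUnion_decode₂, ← hTC, biUnion_eq_iUnion]

theorem IsZeroDimensional.isCountableDisjointUnion_of_isOpen (hX : IsZeroDimensional X)
    {U : Set X} (hU : IsOpen U) : IsCountableDisjointUnion {C | IsClopen C} U := by
  obtain ⟨C, hC, rfl⟩ := hX.exists_clopen_iUnion hU
  exact .iUnion_of_compl isClopen_empty finiteInter_isClopen hC fun k =>
    .of_mem isClopen_empty (hC k).compl

theorem IsZeroDimensional.isSigma0_succ (hX : IsZeroDimensional X) {S : Set X}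
    (hS : IsSigma0 (n + 1) S) : IsSigma0 (n + 2) S := by
  induction n generalizing S with
  | zero =>
    obtain ⟨C, hC, rfl⟩ := hX.exists_clopen_iUnion (isSigma0_one.1 hS)
    exact .iUnion fun i => (isPi0_one.2 (hC i).isClosed).isSigma0_succ
  | succ n ih =>
    obtain ⟨P, hP, rfl⟩ := isSigma0_add_two.1 hS
    exact isSigma0_add_two.2 ⟨P, fun i => ih (hP i), rfl⟩

theorem IsZeroDimensional.isCountableDisjointUnion_of_isSigma0 (hX : IsZeroDimensional X)
    {S : Set X} (hS : IsSigma0 (n + 2) S) :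
    IsCountableDisjointUnion {P | IsPi0 (n + 1) P} S := by
  induction n generalizing S with
  | zero =>
    obtain ⟨P, hP, rfl⟩ := isSigma0_add_two.1 hS
    refine .iUnion_of_compl empty_mem_setOf_isPi0 finiteInter_isPi0 hP fun i => ?_
    exact (hX.isCountableDisjointUnion_of_isOpen (isSigma0_one.1 (hP i))).mono fun C hC =>
      isPi0_one.2 hC.isClosed
  | succ n ih =>
    obtain ⟨P, hP, rfl⟩ := isSigma0_add_two.1 hS
    refine .iUnion_of_compl empty_mem_setOf_isPi0 finiteInter_isPi0 hP fun i => ?_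
    exact (ih (hP i)).mono fun C hC => hX.isSigma0_succ hC

theorem IsZeroDimensional.exists_clopen_mem_iff_finite (hX : IsZeroDimensional X) {S : Set X}
    (hS : IsSigma0 2 S) :
    ∃ C : ℕ → Set X, (∀ m, IsClopen (C m)) ∧ ∀ x, x ∈ S ↔ {m | x ∈ C m}.Finite := by
  obtain ⟨P, hP, rfl⟩ := isSigma0_add_two.1 hS
  exact IsCountableDisjointUnion.exists_mem_iUnion_iff_finite isClopen_empty finiteInter_isClopen
    fun i => hX.isCountableDisjointUnion_of_isOpen (isSigma0_one.1 (hP i))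

theorem IsZeroDimensional.exists_clopen_mem_iff_finite_infinite (hX : IsZeroDimensional X)
    {S : Set X} (hS : IsSigma0 4 S) :
    ∃ C : ℕ × ℕ → Set X, (∀ q, IsClopen (C q)) ∧
      ∀ x, x ∈ S ↔ {n | {m | x ∈ C (n, m)}.Infinite}.Finite := by
  obtain ⟨P, hP, rfl⟩ := isSigma0_add_two.1 hS
  obtain ⟨E, hE, hES⟩ := IsCountableDisjointUnion.exists_mem_iUnion_iff_finite
    empty_mem_setOf_isPi0 finiteInter_isPi0 fun i =>
      hX.isCountableDisjointUnion_of_isSigma0 (hP i)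
  choose C hC hCE using fun n => hX.exists_clopen_mem_iff_finite (hE n)
  refine ⟨fun q => C q.1 q.2, fun q => hC _ _, fun x => ?_⟩
  simp only [hES, Set.Infinite, ← hCE, mem_compl_iff, not_not]

omit [SecondCountableTopology X] in
theorem exists_continuous_setOf_eq_image {ι : Type*} {Y : Type w} {p : ι → Y}
    (hp : Function.Injective p) {C : ι → Set X} (hC : ∀ i, IsClopen (C i)) :
    ∃ F : X → Y → Bool, Continuous F ∧ ∀ x, {y | F x y = true} = p '' {i | x ∈ C i} := by
  refine ⟨fun x y => (⋃ i ∈ p ⁻¹' {y}, C i).boolIndicator x, continuous_pi fun y => ?_, ?_⟩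
  · rw [continuous_boolIndicator_iff_isClopen]
    exact ((finite_singleton y).preimage hp.injOn).isClopen_biUnion fun i _ => hC i
  · intro x
    ext y
    simp [← mem_iff_boolIndicator, and_comm]

end Reductions

section ConvergentArrays

variable {X : Type u} {Y : Type w} [TopologicalSpace X] [TopologicalSpace Y]
  {d : ℕ × ℕ → X} {p : ℕ → X} {q : X}

/-- `d` is an injective array whose `n`-th row `m ↦ d (n, m)` converges to `p n`, where the `p n`
are distinct, and whose rows converge uniformly to `q`. A subset of such an array belongs to the
ideal `convIdeal` if and only if all but finitely many of its rows are finite. -/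
structure IsConvergentArray (d : ℕ × ℕ → X) (p : ℕ → X) (q : X) : Prop where
  injective : Function.Injective d
  limit_injective : Function.Injective p
  tendsto_row : ∀ n, Tendsto (fun m => d (n, m)) atTop (𝓝 (p n))
  tendsto : Tendsto d (comap Prod.fst atTop) (𝓝 q)

namespace IsConvergentArray

theorem of_isInducing {e : X → Y} (he : IsInducing e)
    (h : IsConvergentArray (e ∘ d) (e ∘ p) (e q)) : IsConvergentArray d p q where
  injective := h.injective.of_comp
  limit_injective := h.limit_injective.of_comp
  tendsto_row n := he.tendsto_nhds_iff.2 (h.tendsto_row n)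
  tendsto := he.tendsto_nhds_iff.2 h.tendsto

theorem row_mem_convIdeal (h : IsConvergentArray d p q) (n : ℕ) :
    d '' {r | r.1 = n} ∈ convIdeal X := by
  refine convIdeal_mono ?_ (range_mem_convIdeal (h.tendsto_row n))
  rintro _ ⟨⟨_, m⟩, rfl, rfl⟩
  exact mem_range_self m

theorem image_mem_convIdeal_of_forall_finite (h : IsConvergentArray d p q) {A : Set (ℕ × ℕ)}
    (hA : ∀ n, {m | (n, m) ∈ A}.Finite) : d '' A ∈ convIdeal X := by
  refine mem_convIdeal_of_cofinite_inf_principal_le_nhds (p := q)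
    (A.to_countable.image d) fun V hV => ?_
  obtain ⟨N, hN⟩ := eventually_atTop.1 (eventually_comap.1 (h.tendsto.eventually_mem hV))
  have hfin : (⋃ n < N, (fun m => d (n, m)) '' {m | (n, m) ∈ A}).Finite :=
    (finite_lt_nat N).biUnion fun n _ => (hA n).image _
  filter_upwards [mem_inf_of_left hfin.compl_mem_cofinite,
    mem_inf_of_right (mem_principal_self (d '' A))]
  rintro _ hx ⟨⟨n, m⟩, hA, rfl⟩
  refine hN n (not_lt.1 fun hn => hx ?_) (n, m) rfl
  exact mem_biUnion hn (mem_image_of_mem (fun m => d (n, m)) hA)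

theorem mem_derivedSet_image (h : IsConvergentArray d p q) {A : Set (ℕ × ℕ)} {n : ℕ}
    (hn : {m | (n, m) ∈ A}.Infinite) : p n ∈ derivedSet (d '' A) := by
  have hrow : Tendsto (fun m => d (n, m)) atTop (𝓝[≠] p n) := by
    refine tendsto_nhdsWithin_iff.2 ⟨h.tendsto_row n, ?_⟩
    rw [← Nat.cofinite_eq_atTop]
    exact (h.injective.comp (Prod.mk_right_injective n)).tendsto_cofinite.eventually
      (eventually_cofinite_ne (p n))
  refine accPt_iff_frequently_nhdsNE.2 (hrow.frequently ?_)
  exact (Nat.frequently_atTop_iff_infinite.2 hn).mono fun m hm => mem_image_of_mem d hm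

theorem image_mem_convIdeal_iff [T2Space X] (h : IsConvergentArray d p q) {A : Set (ℕ × ℕ)} :
    d '' A ∈ convIdeal X ↔ {n | {m | (n, m) ∈ A}.Infinite}.Finite := by
  refine ⟨fun hA => ?_, fun hfin => ?_⟩
  · refine ((finite_derivedSet_of_mem_convIdeal hA).preimage h.limit_injective.injOn).subset ?_
    exact fun n hn => h.mem_derivedSet_image hn
  · have hrest : d '' {r ∈ A | {m | (r.1, m) ∈ A}.Finite} ∈ convIdeal X :=
      h.image_mem_convIdeal_of_forall_finite fun n => by
        by_cases hn : {m | (n, m) ∈ A}.Finite <;> simp [hn]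
    refine convIdeal_mono ?_ (union_mem_convIdeal hrest
      (biUnion_mem_convIdeal hfin fun n _ => h.row_mem_convIdeal n))
    rintro _ ⟨r, hr, rfl⟩
    by_cases hn : {m | (r.1, m) ∈ A}.Finite
    · exact Or.inl ⟨r, ⟨hr, hn⟩, rfl⟩
    · exact Or.inr (mem_biUnion hn ⟨r, rfl, rfl⟩)

theorem range_notMem_convIdeal [T2Space X] (h : IsConvergentArray d p q) :
    range d ∉ convIdeal X := by
  rw [← image_univ, h.image_mem_convIdeal_iff]
  simp [infinite_univ]

theorem exists_continuous_mem_convIdeal_iff [T2Space X] (h : IsConvergentArray d p q)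
    {Z : Type v} [TopologicalSpace Z] [SecondCountableTopology Z] (hZ : IsZeroDimensional Z)
    {B : Set Z} (hB : IsSigma0 4 B) :
    ∃ F : Z → X → Bool, Continuous F ∧ F ⁻¹' toCantor (convIdeal X) = B := by
  obtain ⟨C, hC, hCB⟩ := hZ.exists_clopen_mem_iff_finite_infinite hB
  obtain ⟨F, hF, hFC⟩ := exists_continuous_setOf_eq_image h.injective hC
  refine ⟨F, hF, ext fun z => ?_⟩
  rw [mem_preimage, toCantor, mem_ofPred_eq, hFC, h.image_mem_convIdeal_iff]
  exact (hCB z).symm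

end IsConvergentArray

/-- The points `η + ω * n + m + 1`, which for `η = 0` are the isolated points of `ω ^ 2` other
than `0`. -/
noncomputable def ordinalArray (η : Ordinal.{u}) (r : ℕ × ℕ) : Ordinal.{u} :=
  η + (ω * (r.1 : Ordinal) + ((r.2 + 1 : ℕ) : Ordinal))

theorem tendsto_natCast_omega0 : Tendsto (Nat.cast : ℕ → Ordinal.{u}) atTop (𝓝 ω) := by
  rw [← Ordinal.iSup_natCast]
  exact tendsto_atTop_ciSup Nat.mono_cast Ordinal.bddAbove_of_small

theorem lt_ordinalArray (η : Ordinal.{u}) (r : ℕ × ℕ) : η < ordinalArray η r :=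
  lt_add_of_pos_right η (lt_of_lt_of_le (by simp) le_add_self)

theorem ordinalArray_lt_add_omega0_mul (η : Ordinal.{u}) (n m : ℕ) :
    ordinalArray η (n, m) < η + ω * ((n + 1 : ℕ) : Ordinal) := by
  rw [ordinalArray, Nat.cast_succ n, mul_add_one]
  gcongr
  exact Ordinal.natCast_lt_omega0 _

theorem omega0_mul_natCast_lt (n : ℕ) : ω * (n : Ordinal.{u}) < ω ^ (2 : Ordinal.{u}) := by
  rw [← Nat.cast_two, Ordinal.opow_natCast, sq]
  gcongr
  · exact Ordinal.omega0_pos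
  · exact Ordinal.natCast_lt_omega0 n

theorem ordinalArray_lt (η : Ordinal.{u}) (r : ℕ × ℕ) :
    ordinalArray η r < η + ω ^ (2 : Ordinal.{u}) :=
  (ordinalArray_lt_add_omega0_mul η r.1 r.2).trans ((add_lt_add_iff_left η).2
    (omega0_mul_natCast_lt _))

theorem ordinalArray_injective (η : Ordinal.{u}) : Function.Injective (ordinalArray η) := by
  have hdiv (r : ℕ × ℕ) : (ω * (r.1 : Ordinal.{u}) + ((r.2 + 1 : ℕ) : Ordinal)) / ω = r.1 := by
    rw [Ordinal.mul_add_div _ Ordinal.omega0_ne_zero,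
      Ordinal.div_eq_zero_of_lt (Ordinal.natCast_lt_omega0 _), add_zero]
  intro r s hrs
  have hrs := add_left_cancel hrs
  have hfst : r.1 = s.1 := by simpa only [hdiv, Nat.cast_inj] using congrArg (· / ω) hrs
  rw [hfst, add_right_inj, Nat.cast_inj, add_left_inj] at hrs
  exact Prod.ext hfst hrs

theorem isConvergentArray_ordinalArray (η : Ordinal.{u}) :
    IsConvergentArray (ordinalArray η) (fun n => η + ω * ((n + 1 : ℕ) : Ordinal))
      (η + ω ^ (2 : Ordinal.{u})) where
  injective := ordinalArray_injective η
  limit_injective n n' h := by simpa [Ordinal.omega0_ne_zero] using h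
  tendsto_row n := by
    have hnormal := (Ordinal.isNormal_add_right η).comp
      (Ordinal.isNormal_add_right (ω * (n : Ordinal)))
    rw [Nat.cast_succ, mul_add_one]
    exact (hnormal.continuous.tendsto ω).comp
      (tendsto_natCast_omega0.comp (tendsto_add_atTop_nat 1))
  tendsto := by
    have hnormal := (Ordinal.isNormal_add_right η).comp
      (Ordinal.isNormal_mul_right Ordinal.omega0_pos)
    have hlower : Tendsto (fun n : ℕ => η + ω * (n : Ordinal)) atTop
        (𝓝 (η + ω ^ (2 : Ordinal))) := by
      rw [← Nat.cast_two, Ordinal.opow_natCast, sq]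
      exact (hnormal.continuous.tendsto ω).comp tendsto_natCast_omega0
    refine tendsto_of_tendsto_of_tendsto_of_le_of_le (hlower.comp tendsto_comap)
      tendsto_const_nhds (fun r => ?_) fun r => (ordinalArray_lt η r).le
    exact (add_le_add_iff_left η).2 le_self_add

end ConvergentArrays

section Completeness

variable {α : Ordinal.{u}}

theorem exists_isConvergentArray_omegaPowSpace {η : Ordinal.{u}}
    (h : η + ω ^ (2 : Ordinal.{u}) ≤ ω ^ α) :
    ∃ (d : ℕ × ℕ → OmegaPowSpace α) (p : ℕ → OmegaPowSpace α) (q : OmegaPowSpace α),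
      IsConvergentArray d p q ∧ ∀ r, (d r : Ordinal) = ordinalArray η r :=
  have hp (n : ℕ) : η + ω * ((n + 1 : ℕ) : Ordinal) ≤ ω ^ α :=
    ((add_lt_add_iff_left η).2 (omega0_mul_natCast_lt _)).le.trans h
  ⟨fun r => ⟨ordinalArray η r, (ordinalArray_lt η r).le.trans h⟩, fun n => ⟨_, hp n⟩, ⟨_, h⟩,
    .of_isInducing .subtypeVal (isConvergentArray_ordinalArray η), fun _ => rfl⟩

theorem exists_isConvergentArray_omegaPowSpace_lt (hα : 2 ≤ α) :
    ∃ (d : ℕ × ℕ → OmegaPowSpace α) (p : ℕ → OmegaPowSpace α) (q : OmegaPowSpace α),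
      IsConvergentArray d p q ∧ ∀ r, (d r : Ordinal) < ω ^ (2 : Ordinal.{u}) := by
  have hle : ω ^ (2 : Ordinal.{u}) ≤ ω ^ α := Ordinal.opow_le_opow_right Ordinal.omega0_pos hα
  obtain ⟨d, p, q, hd, hdr⟩ := exists_isConvergentArray_omegaPowSpace (η := 0) (by simpa using hle)
  exact ⟨d, p, q, hd, fun r => by simpa [hdr] using ordinalArray_lt 0 r⟩

theorem isIdealOn_convOrd (hα : 2 ≤ α) : IsIdealOn (convOrd α) := by
  obtain ⟨d, p, q, hd, -⟩ := exists_isConvergentArray_omegaPowSpace_lt hα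
  exact isIdealOn_convIdeal fun huniv =>
    hd.range_notMem_convIdeal (convIdeal_mono (subset_univ _) huniv)

theorem isIdealOn_convBelow (hα : Order.IsSuccLimit α) : IsIdealOn (convBelow α) := by
  have h2 : 2 < α := Ordinal.natCast_lt_of_isSuccLimit hα 2
  obtain ⟨d, p, q, hd, hlt⟩ := exists_isConvergentArray_omegaPowSpace_lt h2.le
  refine isIdealOn_convBelow_of_univ_notMem fun huniv => hd.range_notMem_convIdeal ?_
  exact convIdeal_mono (range_subset_iff.2 fun r => mem_inter (mem_univ (d r)) (hlt r))
    (mem_convBelow_iff.1 huniv 2 h2)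

theorem isSigma0Complete_convOrd (h2 : 2 ≤ α) (hα : α.card ≤ Cardinal.aleph0) :
    IsSigma0Complete.{u + 1, v} 4 (toCantor (convOrd α)) := by
  obtain ⟨d, p, q, hd, -⟩ := exists_isConvergentArray_omegaPowSpace_lt h2
  exact ⟨isSigma0_toCantor_convOrd hα, fun Z _ _ hZ B hB =>
    hd.exists_continuous_mem_convIdeal_iff hZ hB⟩

theorem exists_strictMono_cofinal (hl : Order.IsSuccLimit α) (hα : α.card ≤ Cardinal.aleph0) :
    ∃ γ : ℕ → Ordinal.{u}, StrictMono γ ∧ (∀ k, 2 ≤ γ k) ∧ (∀ k, γ k < α) ∧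
      ∀ β < α, ∀ᶠ k in atTop, β ≤ γ k := by
  have := countable_Iio_of_card_le_aleph0 hα
  have : Nonempty (Iio α) := ⟨⟨0, hl.bot_lt⟩⟩
  obtain ⟨b, hb, hbtop⟩ := exists_seq_monotone_tendsto_atTop_atTop (Iio α)
  refine ⟨fun k => (b k : Ordinal) + (k + 2 : ℕ), ?_, fun k => ?_, fun k => ?_, fun β hβ => ?_⟩
  · refine strictMono_nat_of_lt_succ fun k => ?_
    have hle : (b k : Ordinal) ≤ b (k + 1) := hb k.le_succ
    calc (b k : Ordinal) + (k + 2 : ℕ) < b k + (k + 1 + 2 : ℕ) := by gcongr; omega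
      _ ≤ b (k + 1) + (k + 1 + 2 : ℕ) := by gcongr
  · exact le_trans (by simp) le_add_self
  · exact hl.add_natCast_lt (b k).2 _
  · filter_upwards [hbtop.eventually_ge_atTop ⟨β, hβ⟩] with k hk
    exact le_add_right (show β ≤ b k from hk)

theorem omega0_opow_add_omega0_opow_lt {β γ δ : Ordinal.{u}} (hβ : β ≤ γ) (h : γ < δ) :
    ω ^ γ + ω ^ β < ω ^ δ := by
  have hγ : ω ^ γ < ω ^ δ := (Ordinal.opow_lt_opow_iff_right Ordinal.one_lt_omega0).2 h
  exact Ordinal.isPrincipal_add_omega0_opow δ hγ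
    ((Ordinal.opow_le_opow_right Ordinal.omega0_pos hβ).trans_lt hγ)

theorem exists_isConvergentArray_iUnion_image_mem_convBelow_iff (hl : Order.IsSuccLimit α)
    (hα : α.card ≤ Cardinal.aleph0) :
    ∃ d : ℕ → ℕ × ℕ → OmegaPowSpace α, (∀ k, ∃ p q, IsConvergentArray (d k) p q) ∧
      Function.Injective (fun r : ℕ × (ℕ × ℕ) => d r.1 r.2) ∧
      ∀ A : ℕ → Set (ℕ × ℕ),
        ⋃ k, d k '' A k ∈ convBelow α ↔ ∀ k, d k '' A k ∈ convOrd α := by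
  obtain ⟨γ, hmono, hγ2, hγα, hcof⟩ := exists_strictMono_cofinal hl hα
  have hlt {k : ℕ} {δ : Ordinal.{u}} (hδ : γ k < δ) :
      ω ^ γ k + ω ^ (2 : Ordinal.{u}) < ω ^ δ := omega0_opow_add_omega0_opow_lt (hγ2 k) hδ
  choose d p q hd hdr using fun k => exists_isConvergentArray_omegaPowSpace (hlt (hγα k)).le
  have hd_gt (k : ℕ) (r : ℕ × ℕ) : ω ^ γ k < (d k r : Ordinal) := by
    rw [hdr]
    exact lt_ordinalArray _ r
  have hd_lt {k : ℕ} {δ : Ordinal.{u}} (hδ : γ k < δ) (r : ℕ × ℕ) : (d k r : Ordinal) < ω ^ δ := by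
    rw [hdr]
    exact (ordinalArray_lt _ r).trans (hlt hδ)
  have hd_ne {k k' : ℕ} (h : k < k') (r r' : ℕ × ℕ) : d k r ≠ d k' r' := fun heq =>
    ((hd_lt (hmono h) r).trans (hd_gt k' r')).ne (congrArg Subtype.val heq)
  refine ⟨d, fun k => ⟨p k, q k, hd k⟩, ?_, fun A => ⟨fun hA k => ?_, fun hA => ?_⟩⟩
  · rintro ⟨k, r⟩ ⟨k', r'⟩ heq
    obtain rfl : k = k' := by_contra fun hk =>
      (lt_or_gt_of_ne hk).elim (fun h => hd_ne h r r' heq) fun h => hd_ne h r' r heq.symm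
    exact Prod.ext rfl ((hd k).injective heq)
  · refine convIdeal_mono (subset_inter (subset_iUnion (fun k => d k '' A k) k) ?_)
      (mem_convBelow_iff.1 hA (Order.succ (γ k)) (hl.succ_lt (hγα k)))
    exact image_subset_iff.2 fun r _ => hd_lt (Order.lt_succ (γ k)) r
  · refine iUnion_mem_convBelow hA fun β hβ => (hcof β hβ).mono fun k hk => ?_
    exact forall_mem_image.2 fun r _ =>
      (Ordinal.opow_le_opow_right Ordinal.omega0_pos hk).trans (hd_gt k r).le

theorem isPi0Complete_convBelow (hl : Order.IsSuccLimit α) (hα : α.card ≤ Cardinal.aleph0) :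
    IsPi0Complete.{u + 1, v} 5 (toCantor (convBelow α)) := by
  refine ⟨isPi0_toCantor_convBelow hα, fun Z _ _ hZ B hB => ?_⟩
  obtain ⟨d, hd, hinj, hdA⟩ := exists_isConvergentArray_iUnion_image_mem_convBelow_iff hl hα
  choose p q hd using hd
  obtain ⟨P, hP, hBP⟩ := isSigma0_add_two.1 hB
  choose C hC hCP using fun k => hZ.exists_clopen_mem_iff_finite_infinite (hP k)
  obtain ⟨F, hF, hFC⟩ := exists_continuous_setOf_eq_image hinj fun r => hC r.1 r.2
  refine ⟨F, hF, ext fun z => ?_⟩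
  have hFz : {y | F z y = true} = ⋃ k, d k '' {r | z ∈ C k r} := by
    rw [hFC]
    ext y
    simp
  have hB : z ∈ B ↔ ∀ k, z ∈ (P k)ᶜ := by
    rw [← mem_iInter, ← compl_iUnion, ← hBP, compl_compl]
  rw [mem_preimage, toCantor, mem_ofPred_eq, hFz, hdA, hB]
  exact forall_congr' fun k => (hd k).image_mem_convIdeal_iff.trans (hCP k z).symm

end Completeness

section ClusterSets

variable {X : Type u} {Y : Type v} [TopologicalSpace X] [TopologicalSpace Y]
  {f : X → Y} {x : X} {y : Y}

/-- The cluster set of `f` at `x`: the cluster values of `f z` as `z → x` with `z ≠ x`. -/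
def clusterSet (f : X → Y) (x : X) : Set Y :=
  {y | MapClusterPt y (𝓝[≠] x) f}

theorem isClosed_clusterSet : IsClosed (clusterSet f x) :=
  isClosed_setOfPred_clusterPt

theorem clusterSet_nonempty [CompactSpace Y] (f : X → Y) (hx : x ∈ derivedSet univ) :
    (clusterSet f x).Nonempty := by
  have : (𝓝[≠] x).NeBot := by simpa [AccPt] using mem_derivedSet.1 hx
  exact exists_clusterPt_of_compactSpace _

theorem mem_clusterSet_of_mapClusterPt [T1Space X] {F : Filter X} (hF : F ≤ 𝓝[≠] x) {g : X → Y}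
    (hg : ∀ᶠ z in F, g z ∈ clusterSet f z) (hy : MapClusterPt y F g) : y ∈ clusterSet f x := by
  refine mapClusterPt_iff_frequently.2 fun V hV hfar => ?_
  obtain ⟨U, hUV, hU, hyU⟩ := mem_nhds_iff.1 hV
  have hfar' : ∀ᶠ z in F, ∀ᶠ w in 𝓝 z, f w ∉ V :=
    hF (eventually_nhdsNE_eventually_nhds_iff.2 hfar)
  obtain ⟨z, hzU, hz, hzfar⟩ :=
    ((hy.frequently (hU.mem_nhds hyU)).and_eventually (hg.and hfar')).exists
  obtain ⟨w, hwU, hw⟩ := ((MapClusterPt.frequently hz (hU.mem_nhds hzU)).and_eventually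
    (hzfar.filter_mono nhdsWithin_le_nhds)).exists
  exact hw (hUV hwU)

theorem mem_derivedSet_of_tendsto {z : ℕ → X} (hz : Tendsto z atTop (𝓝 x)) (hne : ∀ j, z j ≠ x)
    {A : Set X} (hA : ∀ j, z j ∈ A) : x ∈ derivedSet A := by
  refine mem_derivedSet.2 (accPt_iff_nhds.2 fun U hU => ?_)
  obtain ⟨j, hj⟩ := (hz.eventually_mem hU).exists
  exact ⟨z j, ⟨hj, hA j⟩, hne j⟩

theorem exists_seq_of_mem_clusterSet [FirstCountableTopology X] (h : y ∈ clusterSet f x)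
    {V : ℕ → Set Y} (hV : ∀ j, V j ∈ 𝓝 y) :
    ∃ z : ℕ → X, Tendsto z atTop (𝓝 x) ∧ (∀ j, z j ≠ x) ∧ ∀ j, f (z j) ∈ V j := by
  obtain ⟨B, hB⟩ := (𝓝 x).exists_antitone_basis
  have hz (j : ℕ) : ∃ z, f z ∈ V j ∧ z ∈ B j ∧ z ≠ x :=
    ((MapClusterPt.frequently h (hV j)).and_eventually
      (inter_mem (mem_nhdsWithin_of_mem_nhds (hB.mem j)) self_mem_nhdsWithin)).exists
  choose z hzV hzB hzx using hz
  exact ⟨z, hB.tendsto hzB, hzx, hzV⟩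

theorem exists_mem_convIdeal_of_mem_clusterSet [FirstCountableTopology X]
    [FirstCountableTopology Y] (h : y ∈ clusterSet f x) {V : Set Y} (hV : V ∈ 𝓝 y) :
    ∃ A ∈ convIdeal Y, A ⊆ V ∧ x ∈ derivedSet (f ⁻¹' A) := by
  obtain ⟨B, hB⟩ := (𝓝 y).exists_antitone_basis
  obtain ⟨z, hz, hzx, hzV⟩ := exists_seq_of_mem_clusterSet h fun j => inter_mem (hB.mem j) hV
  have hconv : Tendsto (fun j => f (z j)) atTop (𝓝 y) := hB.tendsto fun j => (hzV j).1
  exact ⟨_, range_mem_convIdeal hconv, range_subset_iff.2 fun j => (hzV j).2,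
    mem_derivedSet_of_tendsto hz hzx fun j => mem_range_self j⟩

variable [T2Space X] [FirstCountableTopology X] (hf : ∀ A ∈ convIdeal Y, f ⁻¹' A ∈ convIdeal X)
include hf

theorem finite_setOf_mem_clusterSet [FirstCountableTopology Y] (y : Y) :
    {x | y ∈ clusterSet f x}.Finite := by
  by_contra hinf
  let e := Set.Infinite.natEmbedding _ hinf
  obtain ⟨B, hB⟩ := (𝓝 y).exists_antitone_basis
  -- A single sequence converging to `y`, enumerated through `Nat.pair`, serves every `e i`.
  choose z hz hzx hzB using fun i =>
    exists_seq_of_mem_clusterSet (e i).2 fun j => hB.mem (Nat.pair i j)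
  have hconv : Tendsto (fun k : ℕ => f (z k.unpair.1 k.unpair.2)) atTop (𝓝 y) :=
    hB.tendsto fun k => by simpa only [Nat.pair_unpair] using hzB k.unpair.1 k.unpair.2
  refine infinite_of_injective_forall_mem (f := fun i => (e i : X))
    (Subtype.val_injective.comp e.injective) (fun i => ?_)
    (finite_derivedSet_of_mem_convIdeal (hf _ (range_mem_convIdeal hconv)))
  exact mem_derivedSet_of_tendsto (hz i) (hzx i) fun j => ⟨Nat.pair i j, by simp⟩

theorem finite_setOf_clusterSet_inter_derivedSet_univ_eq_empty [CompactSpace Y]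
    [FirstCountableTopology Y] :
    {x ∈ derivedSet univ | clusterSet f x ∩ derivedSet univ = ∅}.Finite := by
  by_contra hinf
  let e := Set.Infinite.natEmbedding _ hinf
  choose y hy using fun i => clusterSet_nonempty f (e i).2.1
  obtain ⟨p, φ, hφ, hp⟩ := CompactSpace.tendsto_subseq y
  refine infinite_of_injective_forall_mem (f := fun i => (e (φ i) : X))
    (Subtype.val_injective.comp (e.injective.comp hφ.injective)) (fun i => ?_)
    (finite_derivedSet_of_mem_convIdeal (hf _ (range_mem_convIdeal hp)))
  have hisolated : {y (φ i)} ∈ 𝓝 (y (φ i)) := by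
    have hnot : ¬ AccPt (y (φ i)) (𝓟 univ) := fun hacc =>
      (e (φ i)).2.2.subset ⟨hy (φ i), hacc⟩
    rw [accPt_principal_iff_nhdsWithin, not_neBot, ← compl_eq_univ_sdiff] at hnot
    exact mem_nhds_iff.2 ⟨_, Subset.rfl, isOpen_singleton_iff_punctured_nhds _ |>.2 hnot, rfl⟩
  obtain ⟨z, hz, hzx, hzy⟩ := exists_seq_of_mem_clusterSet (hy (φ i)) fun _ => hisolated
  exact mem_derivedSet_of_tendsto hz hzx fun j => ⟨i, (mem_singleton_iff.1 (hzy j)).symm⟩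

theorem clusterSet_inter_derivedSet_nonempty [CompactSpace Y] [FirstCountableTopology Y]
    {R : Set X} {S : Set Y} (hx : x ∈ derivedSet R)
    (hR : {z ∈ R | clusterSet f z ∩ S = ∅}.Finite) :
    (clusterSet f x ∩ derivedSet S).Nonempty := by
  let F : Filter X := 𝓝[≠] x ⊓ 𝓟 R
  have : F.NeBot := hx
  have havoid {E : Set X} (hE : E.Finite) : ∀ᶠ z in F, z ∉ E :=
    (inf_le_left.trans (nhdsNE_le_cofinite x)) hE.compl_mem_cofinite
  have hgood : ∀ᶠ z in F, (clusterSet f z ∩ S).Nonempty := by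
    filter_upwards [havoid hR, mem_inf_of_right (mem_principal_self R)] with z hz hzR
    exact nonempty_iff_ne_empty.2 fun hempty => hz ⟨hzR, hempty⟩
  have : Nonempty Y := hgood.exists.elim fun _ h => ⟨h.some⟩
  choose! g hg using fun z (hz : (clusterSet f z ∩ S).Nonempty) => hz
  have hgmem : ∀ᶠ z in F, g z ∈ clusterSet f z ∩ S := hgood.mono hg
  obtain ⟨y, hy⟩ : ∃ y, MapClusterPt y F g := exists_clusterPt_of_compactSpace _
  refine ⟨y, mem_clusterSet_of_mapClusterPt inf_le_left (hgmem.mono fun _ h => h.1) hy, ?_⟩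
  refine mem_derivedSet.2 (accPt_iff_nhds.2 fun V hV => ?_)
  obtain ⟨z, hzV, hz, hzy⟩ := ((hy.frequently hV).and_eventually
    (hgmem.and (havoid (finite_setOf_mem_clusterSet hf y)))).exists
  exact ⟨g z, ⟨hzV, hz.2⟩, fun heq => hzy (heq ▸ hz.1)⟩

end ClusterSets

section CantorBendixson

open CantorBendixson

variable {X Y : Type u} [TopologicalSpace X] [TopologicalSpace Y]

theorem iteratedDerivedSet_univ_add_one (γ : Ordinal.{u}) :
    (univ : Set X)ᵈ[γ + 1] = derivedSet (univ : Set X)ᵈ[γ] := by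
  rw [iteratedDerivedSet_succ, (isClosed_iteratedDerivedSet isClosed_univ γ).relDerivedSet_eq]

theorem iteratedDerivedSet_univ_one : (univ : Set X)ᵈ[1] = derivedSet univ := by
  rw [← zero_add 1, iteratedDerivedSet_univ_add_one, iteratedDerivedSet_zero]

theorem preimage_derivedSet_of_isOpenEmbedding {e : X → Y} (he : IsOpenEmbedding e) (S : Set Y) :
    e ⁻¹' derivedSet S = derivedSet (e ⁻¹' S) := by
  ext x
  rw [mem_preimage, mem_derivedSet, mem_derivedSet, ← comap_principal, he.accPt_comap_iff]

theorem preimage_iteratedDerivedSet_univ {e : X → Y} (he : IsOpenEmbedding e) (γ : Ordinal.{u}) :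
    e ⁻¹' (univ : Set Y)ᵈ[γ] = (univ : Set X)ᵈ[γ] := by
  induction γ using Ordinal.limitRecOn with
  | zero => simp only [iteratedDerivedSet_zero, preimage_univ]
  | add_one γ ih =>
    rw [iteratedDerivedSet_univ_add_one, iteratedDerivedSet_univ_add_one,
      preimage_derivedSet_of_isOpenEmbedding he, ih]
  | limit γ hγ ih =>
    rw [iteratedDerivedSet_limit hγ, iteratedDerivedSet_limit hγ, preimage_iInter]
    exact iInter_congr fun δ => ih δ δ.2

variable [T2Space X] [FirstCountableTopology X] [CompactSpace Y] [FirstCountableTopology Y]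

theorem clusterSet_inter_iteratedDerivedSet_nonempty {f : X → Y}
    (hf : ∀ A ∈ convIdeal Y, f ⁻¹' A ∈ convIdeal X) {γ : Ordinal.{u}} (hγ : 1 < γ) {x : X}
    (hx : x ∈ (univ : Set X)ᵈ[γ]) : (clusterSet f x ∩ (univ : Set Y)ᵈ[γ]).Nonempty := by
  induction γ using Ordinal.limitRecOn generalizing x with
  | zero => exact absurd hγ not_lt_zero
  | add_one γ ih =>
    rw [iteratedDerivedSet_univ_add_one] at hx ⊢
    refine clusterSet_inter_derivedSet_nonempty hf hx ?_
    rcases (Order.lt_add_one_iff.1 hγ).eq_or_lt with rfl | h1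
    · simp only [iteratedDerivedSet_univ_one]
      exact finite_setOf_clusterSet_inter_derivedSet_univ_eq_empty hf
    · refine finite_empty.subset fun z hz => ?_
      exact (ih h1 hz.1).ne_empty hz.2
  | limit γ hlim ih =>
    have hne (δ : Iio γ) : (clusterSet f x ∩ (univ : Set Y)ᵈ[δ]).Nonempty := by
      have h2 : max (δ : Ordinal) 2 < γ := max_lt δ.2 (Ordinal.natCast_lt_of_isSuccLimit hlim 2)
      have h12 : 1 < max (δ : Ordinal) 2 := one_lt_two.trans_le (le_max_right _ _)
      exact (ih _ h2 h12 (iteratedDerivedSet_antitone _ h2.le hx)).mono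
        (inter_subset_inter_right _ (iteratedDerivedSet_antitone _ (le_max_left _ _)))
    have hclosed (δ : Iio γ) : IsClosed (clusterSet f x ∩ (univ : Set Y)ᵈ[δ]) :=
      isClosed_clusterSet.inter (isClosed_iteratedDerivedSet isClosed_univ δ)
    have hanti : Antitone fun δ : Iio γ => clusterSet f x ∩ (univ : Set Y)ᵈ[δ] := fun _ _ h =>
      inter_subset_inter_right _ (iteratedDerivedSet_antitone _ h)
    have : Nonempty (Iio γ) := ⟨⟨0, hlim.bot_lt⟩⟩
    rw [iteratedDerivedSet_limit hlim, inter_iInter]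
    exact IsCompact.nonempty_iInter_of_directed_nonempty_isCompact_isClosed _ hanti.directed_ge
      hne (fun δ => (hclosed δ).isCompact) hclosed

theorem KatetovLE.finite_iteratedDerivedSet (h : KatetovLE (convIdeal Y) (convIdeal X))
    {γ : Ordinal.{u}} (hγ : 1 < γ) (hY : ((univ : Set Y)ᵈ[γ]).Finite) :
    ((univ : Set X)ᵈ[γ]).Finite := by
  obtain ⟨f, hf⟩ := h
  refine (hY.biUnion fun y _ => finite_setOf_mem_clusterSet hf y).subset fun x hx => ?_
  obtain ⟨y, hy, hyγ⟩ := clusterSet_inter_iteratedDerivedSet_nonempty hf hγ hx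
  exact mem_biUnion hyγ hy

end CantorBendixson

section OrdinalRank

open CantorBendixson

variable {α γ η ξ : Ordinal.{u}}

theorem omega0_opow_pos (γ : Ordinal.{u}) : 0 < ω ^ γ :=
  Ordinal.opow_pos γ Ordinal.omega0_pos

theorem mul_omega0_dvd_of_mem_derivedSet {S : Set Ordinal.{u}} (hS : ∀ ζ ∈ S, ζ ≠ 0 → η ∣ ζ)
    (hη : η ≠ 0) (hξ : ξ ∈ derivedSet S) : η * ω ∣ ξ := by
  have hbetween : ∀ b < ξ, ∃ c, b < η * c ∧ η * c < ξ := fun b hb => by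
    obtain ⟨ζ, hζ, hbζ, hζξ⟩ := (SuccOrder.accPt_principal.1 hξ).2 b hb
    obtain ⟨c, rfl⟩ := hS ζ hζ hbζ.ne_bot
    exact ⟨c, hbζ, hζξ⟩
  have hpos := pos_iff_ne_zero.2 hη
  have hdvd : η * (ξ / η) = ξ := by
    refine (Ordinal.mul_div_le ξ η).eq_of_not_lt fun hlt => ?_
    obtain ⟨c, hc, hcξ⟩ := hbetween _ hlt
    have h1 : ξ / η < c := (mul_lt_mul_iff_right₀ hpos).1 hc
    have h2 : c < Order.succ (ξ / η) :=
      (mul_lt_mul_iff_right₀ hpos).1 (hcξ.trans (Ordinal.lt_mul_succ_div ξ hη))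
    exact h1.not_ge (Order.lt_succ_iff.1 h2)
  rw [← hdvd]
  refine mul_dvd_mul_left _ (Ordinal.isSuccPrelimit_iff_omega0_dvd.1 ?_)
  refine Order.isSuccPrelimit_of_succ_ne fun b hb => ?_
  obtain ⟨c, hc, hcξ⟩ := hbetween (η * b)
    (hdvd ▸ (mul_lt_mul_iff_right₀ hpos).2 (hb ▸ Order.lt_succ b))
  rw [← hdvd, mul_lt_mul_iff_right₀ hpos, ← hb, Order.lt_succ_iff] at hcξ
  exact hcξ.not_gt ((mul_lt_mul_iff_right₀ hpos).1 hc)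

theorem mem_derivedSet_of_mul_omega0_dvd {S : Set Ordinal.{u}} (hS : ∀ ζ ≠ 0, η ∣ ζ → ζ ∈ S)
    (hξ0 : ξ ≠ 0) (hξ : η * ω ∣ ξ) : ξ ∈ derivedSet S := by
  obtain ⟨c, rfl⟩ := hξ
  rw [mul_assoc] at hξ0 ⊢
  have hη : η ≠ 0 := left_ne_zero_of_mul hξ0
  refine SuccOrder.accPt_principal.2 ⟨by simpa using hξ0, fun b hb => ?_⟩
  have hlim : Order.IsSuccPrelimit (ω * c) :=
    Ordinal.isSuccPrelimit_iff_omega0_dvd.2 (dvd_mul_right ω c)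
  have hb' := Ordinal.lt_mul_succ_div b hη
  exact ⟨η * Order.succ (b / η), hS _ hb'.ne_bot (dvd_mul_right _ _), hb',
    (mul_lt_mul_iff_right₀ (pos_iff_ne_zero.2 hη)).2
      (hlim.succ_lt ((Ordinal.lt_mul_iff_div_lt hη).1 hb))⟩

theorem omega0_opow_dvd_of_forall_lt (hγ : Order.IsSuccLimit γ) (h : ∀ δ < γ, ω ^ δ ∣ ξ) :
    ω ^ γ ∣ ξ := by
  rw [Ordinal.dvd_iff_mod_eq_zero]
  by_contra hr
  obtain ⟨δ, hδ, hlt⟩ := (Ordinal.lt_opow_of_isSuccLimit Ordinal.omega0_ne_zero hγ).1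
    (Ordinal.mod_lt ξ (omega0_opow_pos γ).ne')
  have hdvd : ω ^ δ ∣ ξ % ω ^ γ := by
    have hξ := h δ hδ
    rw [← Ordinal.div_add_mod ξ (ω ^ γ)] at hξ
    exact (Ordinal.dvd_add_iff ((Ordinal.opow_dvd_opow _ hδ.le).mul_right _)).1 hξ
  exact (Ordinal.le_of_dvd hr hdvd).not_gt hlt

theorem mem_iteratedDerivedSet_univ_iff_omega0_opow_dvd (hξ : ξ ≠ 0) :
    ξ ∈ (univ : Set Ordinal.{u})ᵈ[Ordinal.lift.{u + 1} γ] ↔ ω ^ γ ∣ ξ := by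
  induction γ using Ordinal.limitRecOn generalizing ξ with
  | zero => simp only [Ordinal.lift_zero, iteratedDerivedSet_zero, mem_univ, Ordinal.opow_zero,
      one_dvd]
  | add_one γ ih =>
    rw [Ordinal.lift_add, Ordinal.lift_one, iteratedDerivedSet_univ_add_one, Ordinal.opow_add,
      Ordinal.opow_one]
    exact ⟨mul_omega0_dvd_of_mem_derivedSet (fun ζ hζ h0 => (ih h0).1 hζ) (omega0_opow_pos γ).ne',
      mem_derivedSet_of_mul_omega0_dvd (fun ζ h0 hζ => (ih h0).2 hζ) hξ⟩
  | limit γ hγ ih =>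
    rw [iteratedDerivedSet_limit (Ordinal.isSuccLimit_lift.2 hγ), mem_iInter]
    refine ⟨fun h => omega0_opow_dvd_of_forall_lt hγ fun δ hδ => ?_, fun h => ?_⟩
    · exact (ih δ hδ hξ).1 (h ⟨Ordinal.lift.{u + 1} δ, Ordinal.lift_lt.2 hδ⟩)
    · rintro ⟨δ', hδ'⟩
      obtain ⟨δ, hδ, rfl⟩ := Ordinal.lt_lift_iff.1 hδ'
      exact (ih δ hδ hξ).2 ((Ordinal.opow_dvd_opow ω hδ.le).trans h)

theorem isOpenEmbedding_val_omegaPowSpace :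
    IsOpenEmbedding ((↑) : OmegaPowSpace α → Ordinal.{u}) := by
  refine IsOpen.isOpenEmbedding_subtypeVal ?_
  rw [← Order.Iio_succ]
  exact isOpen_Iio

theorem OmegaPowSpace.mem_iteratedDerivedSet_univ_iff {x : OmegaPowSpace α}
    (hx : (x : Ordinal) ≠ 0) :
    x ∈ (univ : Set (OmegaPowSpace α))ᵈ[Ordinal.lift.{u + 1} γ] ↔ ω ^ γ ∣ (x : Ordinal) := by
  rw [← preimage_iteratedDerivedSet_univ isOpenEmbedding_val_omegaPowSpace, mem_preimage,
    mem_iteratedDerivedSet_univ_iff_omega0_opow_dvd hx]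

theorem OmegaPowSpace.le_of_mem_iteratedDerivedSet_univ (hγ : γ ≠ 0) {x : OmegaPowSpace α}
    (hx : x ∈ (univ : Set (OmegaPowSpace α))ᵈ[Ordinal.lift.{u + 1} γ]) :
    ω ^ γ ≤ (x : Ordinal) := by
  have h1 : (x : Ordinal) ∈ (univ : Set Ordinal)ᵈ[1] := by
    rw [← mem_preimage, preimage_iteratedDerivedSet_univ isOpenEmbedding_val_omegaPowSpace]
    exact iteratedDerivedSet_antitone _ (Ordinal.lift_one.{u, u + 1}.symm.trans_le
      (Ordinal.lift_le.2 (Order.one_le_iff_ne_zero.2 hγ))) hx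
  rw [iteratedDerivedSet_univ_one] at h1
  have h0 : (x : Ordinal) ≠ 0 := (AccPt.isSuccLimit h1).bot_lt.ne'
  exact Ordinal.le_of_dvd h0 ((OmegaPowSpace.mem_iteratedDerivedSet_univ_iff h0).1 hx)

theorem OmegaPowSpace.finite_iteratedDerivedSet_univ (hα : α ≠ 0) :
    ((univ : Set (OmegaPowSpace α))ᵈ[Ordinal.lift.{u + 1} α]).Finite :=
  (finite_singleton ⊤).subset fun x hx =>
    Subtype.ext (le_antisymm x.2 (OmegaPowSpace.le_of_mem_iteratedDerivedSet_univ hα hx))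

theorem OmegaPowSpace.infinite_iteratedDerivedSet_univ (h : γ < α) :
    ((univ : Set (OmegaPowSpace α))ᵈ[Ordinal.lift.{u + 1} γ]).Infinite := by
  have hle (n : ℕ) : ω ^ γ * (n + 1 : ℕ) ≤ ω ^ α := calc
    ω ^ γ * (n + 1 : ℕ) ≤ ω ^ γ * ω := by gcongr; exact (Ordinal.natCast_lt_omega0 _).le
    _ = ω ^ Order.succ γ := (Ordinal.opow_succ ω γ).symm
    _ ≤ ω ^ α := Ordinal.opow_le_opow_right Ordinal.omega0_pos (Order.succ_le_of_lt h)
  refine infinite_of_injective_forall_mem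
    (f := fun n : ℕ => (⟨ω ^ γ * (n + 1 : ℕ), hle n⟩ : OmegaPowSpace α)) (fun m n hmn => ?_)
    fun n => ?_
  · have hmn := mul_left_cancel₀ (omega0_opow_pos γ).ne' (congrArg Subtype.val hmn)
    exact Nat.succ_injective (Nat.cast_injective hmn)
  · refine (OmegaPowSpace.mem_iteratedDerivedSet_univ_iff ?_).2 (dvd_mul_right _ _)
    exact mul_ne_zero (omega0_opow_pos γ).ne' (Nat.cast_ne_zero.2 n.succ_ne_zero)

end OrdinalRank

section KatetovOrder

open CantorBendixson

variable {α β : Ordinal.{u}}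

theorem firstCountableTopology_omegaPowSpace (hα : α.card ≤ Cardinal.aleph0) :
    FirstCountableTopology (OmegaPowSpace α) :=
  have := countable_omegaPowSpace hα
  firstCountableTopology_of_orderTopology (OmegaPowSpace α)

theorem one_lt_lift (hα : 1 < α) : 1 < Ordinal.lift.{v} α :=
  Ordinal.lift_one.{u, v}.symm.trans_lt (Ordinal.lift_lt.2 hα)

theorem not_katetovLE_convOrd (h2 : 2 ≤ β) (h : β < α) (hβ : β.card ≤ Cardinal.aleph0) :
    ¬ KatetovLE (convOrd β) (convOrd α) := fun hle => by
  have hsucc : (Order.succ β).card ≤ Cardinal.aleph0 := by simpa using hβ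
  have := firstCountableTopology_omegaPowSpace hβ
  have := firstCountableTopology_omegaPowSpace hsucc
  have := compactSpace_omegaPowSpace β
  have hfin := (hle.trans (katetovLE_convOrd (Order.succ_le_of_lt h))).finite_iteratedDerivedSet
    (one_lt_lift (one_lt_two.trans_le h2))
    (OmegaPowSpace.finite_iteratedDerivedSet_univ (two_pos.trans_le h2).ne')
  exact OmegaPowSpace.infinite_iteratedDerivedSet_univ (Order.lt_succ β) hfin

theorem not_katetovLE_convOrd_convBelow (hα : Order.IsSuccLimit α) (h2 : 2 ≤ β) (h : β < α)
    (hβ : β.card ≤ Cardinal.aleph0) : ¬ KatetovLE (convOrd β) (convBelow α) := fun hle =>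
  not_katetovLE_convOrd h2 (Order.lt_succ β) hβ
    (hle.trans (katetovLE_convBelow_convOrd (hα.succ_lt h)))

theorem not_katetovLE_convBelow (hα : Order.IsSuccLimit α) (hβ : Order.IsSuccLimit β)
    (h : β < α) (hcard : β.card ≤ Cardinal.aleph0) :
    ¬ KatetovLE (convBelow β) (convBelow α) := fun hle =>
  not_katetovLE_convOrd_convBelow hα (Ordinal.natCast_lt_of_isSuccLimit hβ 2).le h hcard
    (katetovLE_convOrd_convBelow.trans hle)

theorem exists_mem_convOrd_mem_derivedSet_preimage (hα : α.card ≤ Cardinal.aleph0)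
    {f : OmegaPowSpace α → OmegaPowSpace α} (hf : ∀ A ∈ convOrd α, f ⁻¹' A ∈ convOrd α)
    (h1 : 1 ≤ β) (h : β < α) :
    ∃ A ∈ convOrd α, (∀ ξ ∈ A, ω ^ β ≤ (ξ : Ordinal)) ∧
      ∃ x ∈ derivedSet (f ⁻¹' A), (x : Ordinal) = ω ^ Order.succ β := by
  have := firstCountableTopology_omegaPowSpace hα
  have := compactSpace_omegaPowSpace α
  let x : OmegaPowSpace α :=
    ⟨ω ^ Order.succ β, Ordinal.opow_le_opow_right Ordinal.omega0_pos (Order.succ_le_of_lt h)⟩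
  have hx : x ∈ (univ : Set (OmegaPowSpace α))ᵈ[Ordinal.lift.{u + 1} (Order.succ β)] :=
    (OmegaPowSpace.mem_iteratedDerivedSet_univ_iff (omega0_opow_pos _).ne').2 dvd_rfl
  obtain ⟨y, hy, hyβ⟩ := clusterSet_inter_iteratedDerivedSet_nonempty hf
    (one_lt_lift (h1.trans_lt (Order.lt_succ β))) hx
  have hlt : ω ^ β < (y : Ordinal) :=
    ((Ordinal.opow_lt_opow_iff_right Ordinal.one_lt_omega0).2 (Order.lt_succ β)).trans_le
      (OmegaPowSpace.le_of_mem_iteratedDerivedSet_univ (Order.succ_ne_bot β) hyβ)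
  have hV : {ξ : OmegaPowSpace α | ω ^ β ≤ (ξ : Ordinal)} ∈ 𝓝 y :=
    continuous_subtype_val.continuousAt.eventually_const_le hlt
  obtain ⟨A, hA, hAV, hxA⟩ := exists_mem_convIdeal_of_mem_clusterSet hy hV
  exact ⟨A, hA, hAV, x, hxA, rfl⟩

theorem not_katetovLE_convBelow_convOrd (hl : Order.IsSuccLimit α)
    (hα : α.card ≤ Cardinal.aleph0) : ¬ KatetovLE (convBelow α) (convOrd α) := by
  rintro ⟨f, hf⟩
  obtain ⟨γ, hmono, h2, hγ, hcofinal⟩ := exists_strictMono_cofinal hl hα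
  choose A hA hγA x hx hxγ using fun k => exists_mem_convOrd_mem_derivedSet_preimage hα
    (fun B hB => hf B (convOrd_subset_convBelow hB)) (one_le_two.trans (h2 k)) (hγ k)
  have hunion : ⋃ k, A k ∈ convBelow α := by
    refine iUnion_mem_convBelow hA fun β hβ => (hcofinal β hβ).mono fun k hk ξ hξ => ?_
    exact (Ordinal.opow_le_opow_right Ordinal.omega0_pos hk).trans (hγA k ξ hξ)
  have hinj : Function.Injective x := fun j k hjk => by
    have hpow : ω ^ Order.succ (γ j) = ω ^ Order.succ (γ k) := by rw [← hxγ, ← hxγ, hjk]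
    exact hmono.injective
      (Order.succ_injective ((Ordinal.opow_right_inj Ordinal.one_lt_omega0).1 hpow))
  exact infinite_of_injective_forall_mem hinj
    (fun k => derivedSet_mono _ _ (preimage_mono (subset_iUnion A k)) (hx k))
    (finite_derivedSet_of_mem_convIdeal (hf _ hunion))

end KatetovOrder

theorem mainTheorem2_general :
    (∀ α : Ordinal.{u}, Order.IsSuccLimit α → IsIdealOn (convBelow α) ∧
      (α.card ≤ Cardinal.aleph0 → IsPi0Complete.{u + 1, v} 5 (toCantor (convBelow α)))) ∧
    (∀ α : Ordinal.{u}, 2 ≤ α → IsIdealOn (convOrd α) ∧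
      (α.card ≤ Cardinal.aleph0 → IsSigma0Complete.{u + 1, v} 4 (toCantor (convOrd α)))) ∧
    (∀ α β : Ordinal.{u}, 2 ≤ β → β < α → β.card ≤ Cardinal.aleph0 →
      KatetovLT (convOrd α) (convOrd β)) ∧
    (∀ α β : Ordinal.{u}, Order.IsSuccLimit α → Order.IsSuccLimit β → β < α →
      β.card ≤ Cardinal.aleph0 → KatetovLT (convBelow α) (convBelow β)) ∧
    (∀ α : Ordinal.{u}, Order.IsSuccLimit α →
      (α.card ≤ Cardinal.aleph0 → KatetovLT (convOrd α) (convBelow α)) ∧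
      ∀ β : Ordinal.{u}, 2 ≤ β → β < α → β.card ≤ Cardinal.aleph0 →
        KatetovLT (convBelow α) (convOrd β)) :=
  ⟨fun _ hα => ⟨isIdealOn_convBelow hα, isPi0Complete_convBelow hα⟩,
    fun _ h2 => ⟨isIdealOn_convOrd h2, isSigma0Complete_convOrd h2⟩,
    fun _ _ h2 h hβ => ⟨katetovLE_convOrd h.le, not_katetovLE_convOrd h2 h hβ⟩,
    fun _ _ hα hβ h hcard => ⟨katetovLE_convBelow h, not_katetovLE_convBelow hα hβ h hcard⟩,
    fun _ hα => ⟨fun hcard => ⟨katetovLE_convOrd_convBelow,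
        not_katetovLE_convBelow_convOrd hα hcard⟩,
      fun _ h2 h hβ => ⟨katetovLE_convBelow_convOrd h,
        not_katetovLE_convOrd_convBelow hα h2 h hβ⟩⟩⟩

theorem mainTheorem2 :
    -- `conv_{<α}` is a `Π⁰₅`-complete ideal for every countable limit ordinal `α`
    (∀ α : Ordinal.{u}, Order.IsSuccLimit α → α.card ≤ Cardinal.aleph0 →
      IsIdealOn (convBelow α) ∧ IsPi0Complete.{u + 1, v} 5 (toCantor (convBelow α))) ∧
    -- `conv_α` is a `Σ⁰₄`-complete ideal for every countable ordinal `α ≥ 2`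
    (∀ α : Ordinal.{u}, 2 ≤ α → α.card ≤ Cardinal.aleph0 →
      IsIdealOn (convOrd α) ∧ IsSigma0Complete.{u + 1, v} 4 (toCantor (convOrd α))) ∧
    -- the ideals `conv_α` strictly decrease in the Katětov order
    (∀ α β : Ordinal.{u}, 2 ≤ β → β < α → α.card ≤ Cardinal.aleph0 →
      KatetovLT (convOrd α) (convOrd β)) ∧
    -- the ideals `conv_{<α}` strictly decrease in the Katětov order
    (∀ α β : Ordinal.{u}, Order.IsSuccLimit α → Order.IsSuccLimit β → β < α →
      α.card ≤ Cardinal.aleph0 → KatetovLT (convBelow α) (convBelow β)) ∧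
    -- the two chains are intertwined
    (∀ α : Ordinal.{u}, Order.IsSuccLimit α → α.card ≤ Cardinal.aleph0 →
      KatetovLT (convOrd α) (convBelow α) ∧
      ∀ β : Ordinal.{u}, 2 ≤ β → β < α → KatetovLT (convBelow α) (convOrd β)) := by
  obtain ⟨hBelow, hOrd, hOrdLT, hBelowLT, hmixed⟩ := mainTheorem2_general.{u, v}
  have hcard {α β : Ordinal.{u}} (h : β < α) (hα : α.card ≤ Cardinal.aleph0) :
      β.card ≤ Cardinal.aleph0 := (Ordinal.card_le_card h.le).trans hα
  exact ⟨fun α hl hα => (hBelow α hl).imp_right fun h => h hα,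
    fun α h2 hα => (hOrd α h2).imp_right fun h => h hα,
    fun α β h2 h hα => hOrdLT α β h2 h (hcard h hα),
    fun α β hlα hlβ h hα => hBelowLT α β hlα hlβ h (hcard h hα),
    fun α hl hα => (hmixed α hl).imp (fun h => h hα) fun h β h2 hβ => h β h2 hβ (hcard hβ hα)⟩
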